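/- Let $d\in\{2,3\}$, let $\tilde\Omega\subset\mathbb R^d$ be a (closed) polyhedral background domain, and let $k,q\ge 1$. Let $\mathcal T_h$ be a conforming simplicial triangulation of $\tilde\Omega$ that is quasi-uniform with parameter $\rho>0$: every $\hat T\in\mathcal T_h$ is closed, has diameter at most $h$ and contains a ball of radius $\rho h$. Let $V_h$ (respectively $V_h^{(q)}$) be the space of continuous functions on $\tilde\Omega$ that are polynomials of degree at most $k$ (respectively $q$) on every element. For $i=0,\dots,N$ let $\Theta^i\colon\tilde\Omega\to\tilde\Omega$ be a bijective mesh deformation with $\Theta^i\in[V_h^{(q)}]^d$ and $\|\Theta^i-\mathrm{id}\|_{\infty,\tilde\Omega}\le C h^2$. Put $\Theta_T^i=\Theta^i|_{\hat T}$, $T^i=\Theta^i(\hat T)$ for $\hat T\in\mathcal T_h$, $\mathcal T_h^i=\{T^i\}$, and $V_h^i=\{w\circ(\Theta^i)^{-1}: w\in V_h\}$. Let $m=n-1$ with $1\le n\le N$. For $v_h\in V_h^m$ define $\Pi^n v_h$ as follows. An asterisk on a polynomial denotes its canonical extension to $\mathbb R^d$, and $\hat T_\varepsilon$ is the closed $\varepsilon$-neighbourhood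 of $\hat T$. (i) On $\Theta_T^{m*}(\hat T_\varepsilon)$ put $v^*_{T^m}=(v_h\circ\Theta_T^m)^*\circ(\Theta_T^{m*}|_{\hat T_\varepsilon})^{-1}$. (ii) On $T^n$ put $\tilde v_{T^n}=\sum_j v^*_{T^m}(\Theta^n(\hat x_j))\,\hat\varphi_j\circ(\Theta_T^n)^{-1}$, where $\hat x_j$ and $\hat\varphi_j$ are the (equispaced) Lagrange nodes and Lagrange basis functions of degree $k$ on $\hat T$. (iii) Put $\Pi^n v_h=\sum_{x_i}\Big(\frac1{\#\omega(x_i)}\sum_{T^n\in\omega(x_i)}\tilde v_{T^n}(x_i)\Big)\varphi_i^n$, where $x_i$ runs over the Lagrange nodes of $\mathcal T_h^n$, $\varphi_i^n$ are the Lagrange basis functions of $V_h^n$, and $\omega(x_i)$ is the set of elements containing $x_i$. Then there are constants $c_\varepsilon,h_0,c>0$, depending only on $d,\tilde\Omega,k,q,\rho,C$ (in particular not on $h$, the mesh, $n$, $N$, the deformations or $v_h$), such that the following holds with $\varepsilon=c_\varepsilon h^2$ whenever $h\le h_0$. For every $\hat T\in\mathcal T_h$ the map $\Theta_T^{m*}$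 is injective on $\hat T_\varepsilon$ and $T^n\subset\Theta_T^{m*}(\hat T_\varepsilon)$, so that $\Pi^n$ is well defined, and $\Pi^n$ maps $V_h^m$ into $V_h^n$. For every $v_h\in V_h^m$ and every $\hat T\in\mathcal T_h$, $$\|(\mathrm{id}-\Pi^n)v_h\|_{L^2(T^n)}\le c\,h^2\|\nabla v_h\|_{L^2(\omega(T^m))}\quad\text{and}\quad h^2\|\nabla v_h\|_{L^2(\omega(T^m))}\le c\,h\,\|v_h\|_{L^2(\omega(T^m))},$$ where $\omega(T^m)$ is the union of all elements of $\mathcal T_h^m$ that meet $T^m$. For every selection $\tilde{\mathcal T}_h\subset\mathcal T_h$, with $\tilde{\mathcal O}_h^n=\bigcup_{\hat T\in\tilde{\mathcal T}_h}T^n$, and $\tilde{\mathcal O}_{h,+}^m$ the union of all $T'^m$ for which $\hat T'\in\mathcal T_h$ shares a vertex with some $\hat T\in\tilde{\mathcal T}_h$, $$\|(\mathrm{id}-\Pi^n)v_h\|_{L^2(\tilde{\mathcal O}_h^n)}\le c\,h^2\|\nabla v_h\|_{L^2(\tilde{\mathcal O}_{h,+}^m)}\quad\text{and}\quad h^2\|\nabla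 v_h\|_{L^2(\tilde{\mathcal O}_{h,+}^m)}\le c\,h\,\|v_h\|_{L^2(\tilde{\mathcal O}_{h,+}^m)}.$$ -/

import Mathlib

open MeasureTheory

namespace MeshTransfer

/-- Euclidean space of dimension `d`. -/
abbrev Space (d : ℕ) := EuclideanSpace ℝ (Fin d)

/-- The closed simplex spanned by a finite set of vertices. -/
abbrev simplex {d : ℕ} (s : Finset (Space d)) : Set (Space d) := convexHull ℝ (s : Set (Space d))

/-! ### Triangulations -/

/-- An admissible (conforming) simplicial triangulation of the (closed) background domain `Ω`:
a finite simplicial complex that covers exactly `Ω` and in which every face belongs to a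
`d`-dimensional simplex. -/
structure Triangulation (d : ℕ) (Ω : Set (Space d)) extends
    Geometry.SimplicialComplex ℝ (Space d) where
  finite_faces : faces.Finite
  space_eq : toSimplicialComplex.space = Ω
  pure : ∀ s ∈ faces, ∃ t ∈ faces, s ⊆ t ∧ t.card = d + 1

/-- The elements of the triangulation: its `d`-dimensional simplices (as vertex sets). -/
noncomputable def Triangulation.elements {d : ℕ} {Ω : Set (Space d)} (K : Triangulation d Ω) :
    Finset (Finset (Space d)) :=
  K.finite_faces.toFinset.filter (fun s => s.card = d + 1)

/-- Quasi-uniformity with parameter `ρ` at mesh size `h`: all elements have diameter at most `h`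
and contain a ball of radius `ρ h`. -/
def Triangulation.IsQuasiUniform {d : ℕ} {Ω : Set (Space d)} (K : Triangulation d Ω)
    (ρ h : ℝ) : Prop :=
  0 < h ∧ ∀ s ∈ K.elements, Metric.diam (simplex s) ≤ h ∧
    ∃ x, Metric.closedBall x (ρ * h) ⊆ simplex s

/-! ### Polynomials and finite element spaces -/

/-- The space of polynomial functions on `ℝ^d` of total degree at most `k`. -/
def polySpace (d k : ℕ) : Set (Space d → ℝ) :=
  {f | ∃ p : MvPolynomial (Fin d) ℝ, p.totalDegree ≤ k ∧
    ∀ x, f x = MvPolynomial.eval (fun i => x i) p}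

/-- Continuous functions on `Ω` whose restriction to each element is a polynomial of degree
at most `k`. Values outside `Ω` are irrelevant. -/
def feSpace {d : ℕ} {Ω : Set (Space d)} (K : Triangulation d Ω) (k : ℕ) : Set (Space d → ℝ) :=
  {v | ContinuousOn v Ω ∧ ∀ s ∈ K.elements, ∃ p ∈ polySpace d k, Set.EqOn v p (simplex s)}

/-- A mesh deformation `Θ : Ω → Ω`: a bijection whose components are continuous piecewise
polynomials of degree `q`, and which differs from the identity by at most `C h²`. -/
structure IsMeshDeformation {d : ℕ} {Ω : Set (Space d)} (K : Triangulation d Ω) (q : ℕ)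
    (C h : ℝ) (Θ : Space d → Space d) : Prop where
  bijOn : Set.BijOn Θ Ω Ω
  mem_feSpace : ∀ j, (fun x => Θ x j) ∈ feSpace K q
  small : ∀ x ∈ Ω, ‖Θ x - x‖ ≤ C * h ^ 2

/-- The inverse of a mesh deformation, as a map `Ω → Ω`. -/
noncomputable def deformInv {d : ℕ} (Ω : Set (Space d)) (Θ : Space d → Space d) :
    Space d → Space d :=
  Function.invFunOn Θ Ω

/-- The mapped finite element space `{w ∘ Θ⁻¹ | w ∈ feSpace K k}` on the deformed mesh. -/
def mappedFESpace {d : ℕ} {Ω : Set (Space d)} (K : Triangulation d Ω) (k : ℕ)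
    (Θ : Space d → Space d) : Set (Space d → ℝ) :=
  {v | ∃ w ∈ feSpace K k, ∀ x ∈ Ω, v x = w (deformInv Ω Θ x)}

/-! ### Lagrange nodes and basis functions -/

/-- Barycentric coordinate of `x` with respect to the vertex `a` of the non-degenerate
`d`-simplex `s`. -/
noncomputable def bary {d : ℕ} (s : Finset (Space d)) (a x : Space d) : ℝ := by
  classical
  exact
    if h : a ∈ s ∧ AffineIndependent ℝ ((↑) : s → Space d) ∧
        affineSpan ℝ (Set.range ((↑) : s → Space d)) = ⊤ then
      (⟨(↑), h.2.1, h.2.2⟩ : AffineBasis s ℝ (Space d)).coord ⟨a, h.1⟩ x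
    else 0

/-- The multi-indices `α` of length `|α| = k` on the vertices of `s`; they index the Lagrange
nodes of degree `k`. -/
noncomputable def nodeIndices {d : ℕ} (k : ℕ) (s : Finset (Space d)) :
    Finset (Space d → ℕ) := by
  classical
  exact s.piAntidiag k

/-- The Lagrange node with barycentric coordinates `α / k`. -/
noncomputable def node {d : ℕ} (k : ℕ) (s : Finset (Space d)) (α : Space d → ℕ) : Space d :=
  ∑ a ∈ s, ((α a : ℝ) / k) • a

/-- The Lagrange basis polynomial of degree `k` on `s` that belongs to the node with index `α`,
written in barycentric coordinates. -/
noncomputable def localBasis {d : ℕ} (k : ℕ) (s : Finset (Space d)) (α : Space d → ℕ)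
    (x : Space d) : ℝ :=
  ∏ a ∈ s, ∏ i ∈ Finset.range (α a), ((k : ℝ) * bary s a x - i) / ((i : ℝ) + 1)

/-- The Lagrange nodes of degree `k` of the undeformed mesh. -/
noncomputable def nodes {d : ℕ} {Ω : Set (Space d)} (K : Triangulation d Ω) (k : ℕ) :
    Finset (Space d) := by
  classical
  exact K.elements.biUnion (fun s => (nodeIndices k s).image (node k s))

/-- The global Lagrange basis function of the node `p` on the undeformed mesh. On an element
containing `x` it is the local basis function of `p`, and zero if `p` is not a node of that
element; the value does not depend on which element containing `x` is chosen. -/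
noncomputable def globalBasis {d : ℕ} {Ω : Set (Space d)} (K : Triangulation d Ω) (k : ℕ)
    (p x : Space d) : ℝ := by
  classical
  exact
    if h : ∃ s ∈ K.elements, x ∈ simplex s then
      ∑ α ∈ (nodeIndices k h.choose).filter (fun α => node k h.choose α = p),
        localBasis k h.choose α x
    else 0

/-- The set of elements of the undeformed mesh that contain the point `p`. -/
noncomputable def elementsAt {d : ℕ} {Ω : Set (Space d)} (K : Triangulation d Ω)
    (p : Space d) : Finset (Finset (Space d)) := by
  classical
  exact K.elements.filter (fun s => p ∈ simplex s)

/-! ### The transfer operator -/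

/-- Canonical polynomial extension: the polynomial of degree at most `k` that agrees with `g` on
the simplex `s`. -/
noncomputable def polyExt {d : ℕ} (k : ℕ) (s : Finset (Space d)) (g : Space d → ℝ) :
    Space d → ℝ := by
  classical
  exact if h : ∃ f ∈ polySpace d k, Set.EqOn f g (simplex s) then h.choose else 0

/-- Canonical extension of the restriction of the deformation `Θ` to the element `s`. -/
noncomputable def deformExt {d : ℕ} (q : ℕ) (s : Finset (Space d)) (Θ : Space d → Space d) :
    Space d → Space d :=
  fun x => WithLp.toLp 2 (fun j => polyExt q s (fun y => Θ y j) x)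

/-- The (closed) `ε`-neighbourhood of the element `s`. -/
def inflated {d : ℕ} (ε : ℝ) (s : Finset (Space d)) : Set (Space d) :=
  Metric.cthickening ε (simplex s)

/-- The smooth extension of `v` from the deformed element `Θ s` to the image of the
`ε`-neighbourhood of `s` under the extended deformation. -/
noncomputable def elementExt {d : ℕ} (k q : ℕ) (ε : ℝ) (Θ : Space d → Space d)
    (v : Space d → ℝ) (s : Finset (Space d)) : Space d → ℝ :=
  fun x => polyExt k s (v ∘ Θ) (Function.invFunOn (deformExt q s Θ) (inflated ε s) x)

/-- Shifted nodal evaluation on the element `s`, pulled back to the undeformed element: the local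
extension of `v` from the old deformed element is evaluated at the new deformed nodes. -/
noncomputable def shiftedInterp {d : ℕ} (k q : ℕ) (ε : ℝ) (Θold Θnew : Space d → Space d)
    (v : Space d → ℝ) (s : Finset (Space d)) : Space d → ℝ :=
  fun x => ∑ α ∈ nodeIndices k s,
    elementExt k q ε Θold v s (Θnew (node k s α)) * localBasis k s α x

/-- Oswald quasi-interpolation on the undeformed mesh of an elementwise given function `g`: nodal
values are averaged over all elements that contain the node. -/
noncomputable def oswald {d : ℕ} {Ω : Set (Space d)} (K : Triangulation d Ω) (k : ℕ)
    (g : Finset (Space d) → Space d → ℝ) : Space d → ℝ :=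
  fun x => ∑ p ∈ nodes K k,
    (((elementsAt K p).card : ℝ)⁻¹ * ∑ s ∈ elementsAt K p, g s p) * globalBasis K k p x

/-- The transfer operator from the mesh deformed by `Θold` to the mesh deformed by `Θnew`. -/
noncomputable def transfer {d : ℕ} {Ω : Set (Space d)} (K : Triangulation d Ω) (k q : ℕ) (ε : ℝ)
    (Θold Θnew : Space d → Space d) (v : Space d → ℝ) : Space d → ℝ :=
  fun x => oswald K k (shiftedInterp k q ε Θold Θnew v) (deformInv Ω Θnew x)

/-! ### Patches and norms -/

/-- The domain covered by the deformed elements `Θ s`, `s ∈ S`. -/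
def deformedDomain {d : ℕ} (Θ : Space d → Space d) (S : Set (Finset (Space d))) :
    Set (Space d) :=
  ⋃ s ∈ S, Θ '' simplex s

/-- The element patch of `s`: all elements whose deformed versions touch the deformed `s`. -/
def patch {d : ℕ} {Ω : Set (Space d)} (K : Triangulation d Ω) (Θ : Space d → Space d)
    (s : Finset (Space d)) : Set (Finset (Space d)) :=
  {t | t ∈ K.elements ∧ (Θ '' simplex s ∩ Θ '' simplex t).Nonempty}

/-- A selection of elements enlarged by one layer: all elements that share a vertex with one of
the selected elements. -/
def enlarge {d : ℕ} {Ω : Set (Space d)} (K : Triangulation d Ω)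
    (S : Set (Finset (Space d))) : Set (Finset (Space d)) :=
  {t | t ∈ K.elements ∧ ∃ s ∈ S, ∃ a ∈ s, a ∈ t}

/-- The `L²` norm of `v` on the set `D`. -/
noncomputable def l2norm {d : ℕ} (D : Set (Space d)) (v : Space d → ℝ) : ENNReal :=
  eLpNorm v 2 (volume.restrict D)

/-- The `L²` norm on `D` of the gradient of `v`. -/
noncomputable def l2normGrad {d : ℕ} (D : Set (Space d)) (v : Space d → ℝ) : ENNReal :=
  eLpNorm (fun x => gradient v x) 2 (volume.restrict D)

end MeshTransfer

/-!
# Transfer of finite element functions between deformed meshes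

Fix an element `t` and write `Ψ` for the polynomial extension of the old deformation `Θ` from `t`,
and `W` for that of `v ∘ Θ`. Everything rests on estimates for polynomials of bounded degree on
balls, which follow from one-dimensional Lagrange interpolation along lines: as `t` contains a ball
of radius `ρ h` and is contained in a concentric one of radius `h`, the size of a polynomial and of
`h` times its derivative on a ball of radius `3 h` is controlled by its size on `t`
(`exists_ball_bound`), and even by its smallest value on some ball of radius `δ h` inside `t`
(`exists_ball_lower_bound`). No reference element is needed.

Applied to `Ψ - id`, which is of size `C h²`, this gives `‖DΨ - id‖ ≤ 1/2` for small `h`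
(`exists_isNearId_deformExt`). Hence `Ψ` is injective near `t`, images of balls contain balls of half
the radius, and the gradient of `v` at `Ψ y` is comparable to that of `W` at `y`. Applied to `W`, it
gives the inverse estimate on a deformed element (`exists_inverse_estimate`), as well as a bound
`M` for `∇W` such that `h ^ d * M ^ 2` is at most a constant times the square integral of `∇v` over
the deformed element (`exists_gradient_lower_bound`).

The error at `x = Θ' ξ` with `ξ ∈ s` has two parts (`DeformationPair.abs_sub_transfer_le`).

* The difference of `v (Θ ξ)` and the transferred value: Lagrange interpolation reproduces
  `W` (`IsFullSimplex.eq_sum_localBasis`), so this is an interpolated average of differences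
  `W (z) - W (p)` with nodes `p` and `‖z - p‖ ≤ 4 C h²`, taken over the elements at a node.
* The difference of `v (Θ ξ)` and `v (Θ' ξ)`, that is, of `v ∘ Θ` at `ξ` and at `η = Θ⁻¹ (Θ' ξ)`, where
  `‖ξ - η‖ ≤ 2 C h²`. Here the geometry of the domain enters: a triangulated domain is locally
  quasi-convex (`Triangulation.exists_quasiconvex`), so `ξ` and `η` are joined by a path of length
  `O(h²)` in the domain. Along this path the sum of the hat functions of the vertices of `s`, which
  is `1` at `ξ` and has Lipschitz constant of order `1 / h`, stays positive, so the path only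
  meets elements that share a vertex with `s` (`Triangulation.exists_patch_lipschitz`).

Both parts are at most a constant times `h²` times the largest `M` on the patch of `s`. Squaring,
integrating and summing over the elements gives the error estimates, since every element lies in
boundedly many patches (`card_enlarge_le`) and distinct deformed elements overlap in null sets
only. As `Θ` is injective, the patch of a deformed element consists of the elements that share a
vertex with it, so the local estimates are those for a selection of one element.
-/

namespace MeshTransfer

open Metric Set

/-! ### Polynomial functions -/

section Polynomials

variable {d : ℕ}

lemma polySpace_mono {k l : ℕ} (hkl : k ≤ l) : polySpace d k ⊆ polySpace d l := by
  rintro f ⟨p, hp, hf⟩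
  exact ⟨p, hp.trans hkl, hf⟩

lemma const_mem_polySpace (k : ℕ) (c : ℝ) : (fun _ => c) ∈ polySpace d k :=
  ⟨MvPolynomial.C c, by simp, by simp⟩

lemma coord_mem_polySpace (i : Fin d) : (fun x : Space d => x i) ∈ polySpace d 1 :=
  ⟨MvPolynomial.X i, by simp, by simp⟩

lemma add_mem_polySpace {k : ℕ} {f g : Space d → ℝ} (hf : f ∈ polySpace d k)
    (hg : g ∈ polySpace d k) : (fun x => f x + g x) ∈ polySpace d k := by
  obtain ⟨p, hp, hf⟩ := hf
  obtain ⟨r, hr, hg⟩ := hg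
  refine ⟨p + r, (MvPolynomial.totalDegree_add _ _).trans (max_le hp hr), fun x => ?_⟩
  simp [hf, hg]

lemma mul_mem_polySpace {k l : ℕ} {f g : Space d → ℝ} (hf : f ∈ polySpace d k)
    (hg : g ∈ polySpace d l) : (fun x => f x * g x) ∈ polySpace d (k + l) := by
  obtain ⟨p, hp, hf⟩ := hf
  obtain ⟨r, hr, hg⟩ := hg
  refine ⟨p * r, (MvPolynomial.totalDegree_mul _ _).trans (add_le_add hp hr), fun x => ?_⟩
  simp [hf, hg]

lemma const_mul_mem_polySpace {k : ℕ} {f : Space d → ℝ} (c : ℝ) (hf : f ∈ polySpace d k) :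
    (fun x => c * f x) ∈ polySpace d k := by
  simpa using mul_mem_polySpace (const_mem_polySpace 0 c) hf

lemma sum_mem_polySpace {ι : Type*} {k : ℕ} (s : Finset ι) {f : ι → Space d → ℝ}
    (hf : ∀ i ∈ s, f i ∈ polySpace d k) : (fun x => ∑ i ∈ s, f i x) ∈ polySpace d k := by
  classical
  induction s using Finset.induction_on with
  | empty => simpa using const_mem_polySpace k 0
  | insert a s ha ih =>
    simp only [Finset.sum_insert ha]
    exact add_mem_polySpace (hf a (by simp)) (ih fun i hi => hf i (by simp [hi]))

lemma prod_mem_polySpace {ι : Type*} (s : Finset ι) {k : ι → ℕ} {f : ι → Space d → ℝ}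
    (hf : ∀ i ∈ s, f i ∈ polySpace d (k i)) :
    (fun x => ∏ i ∈ s, f i x) ∈ polySpace d (∑ i ∈ s, k i) := by
  classical
  induction s using Finset.induction_on with
  | empty => simpa using const_mem_polySpace 0 1
  | insert a s ha ih =>
    simp only [Finset.prod_insert ha, Finset.sum_insert ha]
    exact mul_mem_polySpace (hf a (by simp)) (ih fun i hi => hf i (by simp [hi]))

lemma totalDegree_pderiv_le (i : Fin d) (p : MvPolynomial (Fin d) ℝ) :
    (MvPolynomial.pderiv i p).totalDegree ≤ p.totalDegree := by
  conv_lhs => rw [p.as_sum, map_sum]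
  refine MvPolynomial.totalDegree_finsetSum_le fun s hs => ?_
  rw [MvPolynomial.pderiv_monomial]
  refine (MvPolynomial.totalDegree_monomial_le _ _).trans ?_
  refine le_trans ?_ (MvPolynomial.le_totalDegree hs)
  exact Finsupp.sum_le_sum_index tsub_le_self (fun _ _ _ _ h => h) (by simp)

lemma hasFDerivAt_eval (p : MvPolynomial (Fin d) ℝ) (x : Space d) :
    HasFDerivAt (fun y : Space d => MvPolynomial.eval (fun i => y i) p)
      (∑ i, MvPolynomial.eval (fun i => x i) (MvPolynomial.pderiv i p) •
        (EuclideanSpace.proj i : Space d →L[ℝ] ℝ)) x := by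
  induction p using MvPolynomial.induction_on with
  | C a => simpa using hasFDerivAt_const a x
  | add p r hp hr =>
    simp only [map_add, add_smul, Finset.sum_add_distrib]
    exact hp.add hr
  | mul_X p j hp =>
    have h1 : HasFDerivAt (fun y : Space d => y j)
        (EuclideanSpace.proj j : Space d →L[ℝ] ℝ) x :=
      (EuclideanSpace.proj j : Space d →L[ℝ] ℝ).hasFDerivAt
    simp only [map_mul, MvPolynomial.eval_X]
    convert! hp.mul h1 using 1
    ext e
    simp [MvPolynomial.pderiv_X, Pi.single_apply, add_mul, Finset.sum_add_distrib,
      Finset.mul_sum, mul_ite]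
    simp [ite_mul, apply_ite, Finset.sum_ite_eq]
    exact Finset.sum_congr rfl fun i _ => by ring

lemma differentiable_of_mem_polySpace {k : ℕ} {f : Space d → ℝ} (hf : f ∈ polySpace d k) :
    Differentiable ℝ f := by
  obtain ⟨p, -, hf⟩ := hf
  obtain rfl := funext hf
  exact fun x => (hasFDerivAt_eval p x).differentiableAt

lemma fderiv_apply_mem_polySpace {k : ℕ} {f : Space d → ℝ} (hf : f ∈ polySpace d k)
    (e : Space d) : (fun x => fderiv ℝ f x e) ∈ polySpace d k := by
  obtain ⟨p, hp, hf⟩ := hf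
  obtain rfl := funext hf
  have : (fun x => fderiv ℝ (fun y : Space d => MvPolynomial.eval (fun i => y i) p) x e) =
      fun x : Space d => ∑ i, e i *
        MvPolynomial.eval (fun i => x i) (MvPolynomial.pderiv i p) := by
    funext x
    rw [(hasFDerivAt_eval p x).fderiv]
    simp [mul_comm]
  rw [this]
  exact sum_mem_polySpace _ fun i _ => const_mul_mem_polySpace _
    ⟨_, (totalDegree_pderiv_le i p).trans hp, fun _ => rfl⟩

lemma continuous_fderiv_of_mem_polySpace {k : ℕ} {f : Space d → ℝ} (hf : f ∈ polySpace d k) :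
    Continuous (fderiv ℝ f) := by
  refine continuous_clm_apply.2 fun e => ?_
  exact (differentiable_of_mem_polySpace (fderiv_apply_mem_polySpace hf e)).continuous

/-- The restriction of a polynomial function to a line is a univariate polynomial. -/
lemma exists_polynomial_on_line {k : ℕ} {f : Space d → ℝ} (hf : f ∈ polySpace d k)
    (x e : Space d) : ∃ r : Polynomial ℝ, r.natDegree ≤ k ∧ ∀ t : ℝ, f (x + t • e) = r.eval t := by
  obtain ⟨p, hp, hf⟩ := hf
  refine ⟨MvPolynomial.aeval (fun i => Polynomial.C (x i) + Polynomial.C (e i) * Polynomial.X) p,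
    ?_, fun t => ?_⟩
  · simpa using MvPolynomial.aeval_natDegree_le p hp
      (fun i => Polynomial.C (x i) + Polynomial.C (e i) * Polynomial.X) (n := 1)
      (fun i => by compute_degree)
  · rw [hf]
    clear hp hf
    induction p using MvPolynomial.induction_on with
    | C a => simp
    | add p r hp hr => simp only [map_add, Polynomial.eval_add, hp, hr]
    | mul_X p j hp =>
      rw [map_mul, map_mul, Polynomial.eval_mul, hp]
      simp [mul_comm t]

/-- A univariate polynomial of bounded degree and its derivative are controlled on any bounded
interval by the maximum of the polynomial on the unit interval. -/
lemma exists_univariate_bound (k : ℕ) (R : ℝ) : ∃ A : ℝ, 1 ≤ A ∧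
    ∀ r : Polynomial ℝ, r.natDegree ≤ k → ∀ M : ℝ, (∀ t ∈ Icc (0 : ℝ) 1, |r.eval t| ≤ M) →
      ∀ t ∈ Icc (-R) R, |r.eval t| ≤ A * M ∧ |r.derivative.eval t| ≤ A * M := by
  let v : ℕ → ℝ := fun i => (i : ℝ) / (k + 1)
  have hk : (0 : ℝ) < k + 1 := by positivity
  have hv : Set.InjOn v (Finset.range (k + 1)) := fun i _ j _ hij => by
    have := (div_left_inj' hk.ne').1 hij
    exact_mod_cast this
  let b : ℕ → Polynomial ℝ := fun i => Lagrange.basis (Finset.range (k + 1)) v i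
  have hb : ∀ r : Polynomial ℝ, ∃ B, ∀ t ∈ Icc (-R) R, |r.eval t| ≤ B := fun r =>
    isCompact_Icc.exists_bound_of_continuousOn (f := fun t => r.eval t) r.continuous.continuousOn
  choose B hB using hb
  let A : ℝ := 1 + ∑ i ∈ Finset.range (k + 1), (|B (b i)| + |B (b i).derivative|)
  have hA : (1 : ℝ) ≤ A := by
    have : 0 ≤ ∑ i ∈ Finset.range (k + 1), (|B (b i)| + |B (b i).derivative|) :=
      Finset.sum_nonneg fun i _ => by positivity
    simp only [A]; linarith
  refine ⟨A, hA, fun r hr M hM t ht => ?_⟩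
  have hM0 : 0 ≤ M := (abs_nonneg _).trans (hM 0 (by simp))
  have hreq : r = ∑ i ∈ Finset.range (k + 1), Polynomial.C (r.eval (v i)) * b i := by
    conv_lhs => rw [Lagrange.eq_interpolate (f := r) hv (by
      rw [Finset.card_range]
      exact (Polynomial.degree_le_natDegree).trans_lt (by exact_mod_cast Nat.lt_succ_of_le hr))]
    rw [Lagrange.interpolate_apply]
  have hvm : ∀ i ∈ Finset.range (k + 1), |r.eval (v i)| ≤ M := fun i hi => by
    refine hM _ ⟨by positivity, ?_⟩
    rw [div_le_one hk]
    exact_mod_cast (Finset.mem_range.1 hi).le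
  constructor
  · calc |r.eval t| = |∑ i ∈ Finset.range (k + 1), r.eval (v i) * (b i).eval t| := by
          conv_lhs => rw [hreq, Polynomial.eval_finsetSum]
          simp
      _ ≤ ∑ i ∈ Finset.range (k + 1), |r.eval (v i) * (b i).eval t| :=
          Finset.abs_sum_le_sum_abs _ _
      _ ≤ ∑ i ∈ Finset.range (k + 1), (|B (b i)| + |B (b i).derivative|) * M := by
          refine Finset.sum_le_sum fun i hi => ?_
          rw [abs_mul, mul_comm]
          refine mul_le_mul ?_ (hvm i hi) (abs_nonneg _) (by positivity)
          exact ((hB _ t ht).trans (le_abs_self _)).trans (by simp)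
      _ ≤ A * M := by
          rw [← Finset.sum_mul]
          exact mul_le_mul_of_nonneg_right (by simp [A]) hM0
  · calc |r.derivative.eval t|
        = |∑ i ∈ Finset.range (k + 1), r.eval (v i) * (b i).derivative.eval t| := by
          conv_lhs => rw [hreq, Polynomial.derivative_sum, Polynomial.eval_finsetSum]
          simp
      _ ≤ ∑ i ∈ Finset.range (k + 1), |r.eval (v i) * (b i).derivative.eval t| :=
          Finset.abs_sum_le_sum_abs _ _
      _ ≤ ∑ i ∈ Finset.range (k + 1), (|B (b i)| + |B (b i).derivative|) * M := by
          refine Finset.sum_le_sum fun i hi => ?_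
          rw [abs_mul, mul_comm]
          refine mul_le_mul ?_ (hvm i hi) (abs_nonneg _) (by positivity)
          exact ((hB _ t ht).trans (le_abs_self _)).trans (by simp)
      _ ≤ A * M := by
          rw [← Finset.sum_mul]
          exact mul_le_mul_of_nonneg_right (by simp [A]) hM0

/-- Extension and inverse estimate: on the ball of radius `3 h`, a polynomial and `h` times its
derivative are controlled by the maximum of the polynomial on the concentric ball of radius
`ρ h`. -/
lemma exists_ball_bound (d k : ℕ) {ρ : ℝ} (hρ : 0 < ρ) : ∃ A : ℝ, 1 ≤ A ∧
    ∀ p ∈ polySpace d k, ∀ (x₀ : Space d) (h M : ℝ), 0 < h →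
      (∀ x ∈ closedBall x₀ (ρ * h), |p x| ≤ M) →
      ∀ x ∈ closedBall x₀ (3 * h), |p x| ≤ A * M ∧ ‖fderiv ℝ p x‖ ≤ A * M / h := by
  obtain ⟨A₁, hA₁, H₁⟩ := exists_univariate_bound k (4 / ρ)
  obtain ⟨A₂, hA₂, H₂⟩ := exists_univariate_bound k 1
  have hA : A₁ ≤ A₂ * A₁ := le_mul_of_one_le_left (by linarith) hA₂
  refine ⟨A₂ * A₁, hA₁.trans hA, fun p hp x₀ h M hh hM => ?_⟩
  have hM0 : 0 ≤ M := (abs_nonneg _).trans (hM x₀ (mem_closedBall_self (by positivity)))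
  have key : ∀ x ∈ closedBall x₀ (4 * h), |p x| ≤ A₁ * M := fun x hx => by
    rw [mem_closedBall, dist_eq_norm] at hx
    obtain ⟨r, hr, hrp⟩ := exists_polynomial_on_line hp x₀ ((ρ / 4) • (x - x₀))
    have := (H₁ r hr M (fun t ht => ?_) (4 / ρ) ⟨by linarith [div_pos four_pos hρ], le_rfl⟩).1
    · rw [← hrp, smul_smul, div_mul_div_cancel₀ hρ.ne'] at this
      simpa using this
    · rw [← hrp]
      refine hM _ ?_
      rw [mem_closedBall, dist_eq_norm, add_sub_cancel_left, norm_smul, norm_smul,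
        Real.norm_of_nonneg ht.1, Real.norm_of_nonneg (by positivity)]
      calc t * (ρ / 4 * ‖x - x₀‖) ≤ 1 * (ρ / 4 * (4 * h)) := by
            gcongr
            exact ht.2
        _ = ρ * h := by ring
  intro x hx
  refine ⟨(key x (closedBall_subset_closedBall (by linarith) hx)).trans (by gcongr), ?_⟩
  refine ContinuousLinearMap.opNorm_le_of_unit_norm (by positivity) fun e he => ?_
  obtain ⟨r, hr, hrp⟩ := exists_polynomial_on_line hp x (h • e)
  have h1 := (H₂ r hr (A₁ * M) (fun t ht => ?_) 0 ⟨by norm_num, by norm_num⟩).2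
  · have h2 : HasDerivAt (fun t : ℝ => p (x + t • (h • e))) (fderiv ℝ p x (h • e)) 0 := by
      have h3 : HasDerivAt (fun t : ℝ => x + t • (h • e)) (h • e) 0 := by
        simpa using ((hasDerivAt_id (0 : ℝ)).smul_const (h • e)).const_add x
      have h4 : HasFDerivAt p (fderiv ℝ p x) (x + (0 : ℝ) • (h • e)) := by
        simpa using (differentiable_of_mem_polySpace hp x).hasFDerivAt
      exact h4.comp_hasDerivAt 0 h3
    simp only [hrp] at h2
    rw [← h2.unique (r.hasDerivAt 0), map_smul, smul_eq_mul, abs_mul, abs_of_pos hh] at h1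
    rw [Real.norm_eq_abs, le_div_iff₀ hh]
    linarith
  · rw [← hrp]
    refine key _ ?_
    rw [mem_closedBall, dist_eq_norm] at hx ⊢
    calc ‖x + t • h • e - x₀‖ ≤ ‖x - x₀‖ + ‖t • h • e‖ := by
          rw [add_sub_right_comm]; exact norm_add_le _ _
      _ ≤ 3 * h + 1 * (h * 1) := by
          rw [norm_smul, norm_smul, Real.norm_of_nonneg ht.1, Real.norm_of_nonneg hh.le, he]
          gcongr
          exact ht.2
      _ = 4 * h := by ring

/-- On a ball whose radius is a fixed fraction of `h`, a polynomial is bounded below by a fixed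
fraction of its maximum on a ball of radius `3 h`. This replaces equivalence of norms on a
reference element. -/
lemma exists_ball_lower_bound (d k : ℕ) {ρ : ℝ} (hρ : 0 < ρ) (hρ1 : ρ ≤ 1) :
    ∃ A δ : ℝ, 1 ≤ A ∧ 0 < δ ∧ ∀ p ∈ polySpace d k, ∀ (x₀ : Space d) (h : ℝ), 0 < h →
      ∃ M : ℝ, 0 ≤ M ∧ (∃ y₀, ball y₀ (δ * h) ⊆ ball x₀ (ρ * h) ∧
        ∀ x ∈ ball y₀ (δ * h), M ≤ |p x|) ∧
      ∀ x ∈ closedBall x₀ (3 * h), |p x| ≤ A * M ∧ ‖fderiv ℝ p x‖ ≤ A * M / h := by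
  obtain ⟨A, hA, H⟩ := exists_ball_bound d k (half_pos hρ)
  have hA0 : 0 < A := by linarith
  refine ⟨2 * A, min (ρ / 2) (1 / (2 * A)), by linarith, by positivity,
    fun p hp x₀ h hh => ?_⟩
  obtain ⟨y, hy, hmax⟩ := (isCompact_closedBall x₀ (ρ / 2 * h)).exists_isMaxOn
    (nonempty_closedBall.2 (by positivity))
    (continuous_abs.comp (differentiable_of_mem_polySpace hp).continuous).continuousOn
  have Hb := H p hp x₀ h |p y| hh fun x hx => hmax hx
  have hsub : ball y (min (ρ / 2) (1 / (2 * A)) * h) ⊆ ball x₀ (ρ * h) := by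
    refine ball_subset_ball' ?_
    have h1 : min (ρ / 2) (1 / (2 * A)) * h ≤ ρ / 2 * h := by gcongr; exact min_le_left _ _
    rw [mem_closedBall] at hy
    linarith
  refine ⟨|p y| / 2, by positivity, ⟨y, hsub, fun x hx => ?_⟩, fun x hx => ?_⟩
  · have hsub3 : ball x₀ (ρ * h) ⊆ closedBall x₀ (3 * h) :=
      ball_subset_closedBall.trans (closedBall_subset_closedBall (by nlinarith))
    have h1 : ‖p x - p y‖ ≤ A * |p y| / h * ‖x - y‖ :=
      (convex_ball y (min (ρ / 2) (1 / (2 * A)) * h)).norm_image_sub_le_of_norm_fderiv_le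
        (fun z _ => differentiable_of_mem_polySpace hp z)
        (fun z hz => (Hb z (hsub3 (hsub hz))).2) (mem_ball_self (by positivity)) hx
    have h2 : ‖x - y‖ ≤ 1 / (2 * A) * h := by
      rw [mem_ball, dist_eq_norm] at hx
      refine hx.le.trans ?_
      gcongr
      exact min_le_right _ _
    have h3 : A * |p y| / h * ‖x - y‖ ≤ |p y| / 2 := by
      calc A * |p y| / h * ‖x - y‖ ≤ A * |p y| / h * (1 / (2 * A) * h) := by gcongr
        _ = |p y| / 2 := by field_simp
    rw [Real.norm_eq_abs] at h1
    have h4 := abs_sub_abs_le_abs_sub (p y) (p x)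
    rw [abs_sub_comm] at h4
    linarith
  · have := Hb x hx
    constructor
    · calc _ ≤ _ := this.1
        _ = _ := by ring
    · calc _ ≤ _ := this.2
        _ = _ := by ring

/-- The counterpart of `exists_ball_lower_bound` for the derivative of a polynomial. -/
lemma exists_ball_lower_bound_fderiv (d k : ℕ) {ρ : ℝ} (hρ : 0 < ρ) (hρ1 : ρ ≤ 1) :
    ∃ A δ : ℝ, 1 ≤ A ∧ 0 < δ ∧ ∀ p ∈ polySpace d k, ∀ (x₀ : Space d) (h : ℝ), 0 < h →
      ∃ M : ℝ, 0 ≤ M ∧ (∃ y₀, ball y₀ (δ * h) ⊆ ball x₀ (ρ * h) ∧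
        ∀ x ∈ ball y₀ (δ * h), M ≤ ‖fderiv ℝ p x‖) ∧
      ∀ x ∈ closedBall x₀ (3 * h), ‖fderiv ℝ p x‖ ≤ A * M := by
  obtain ⟨A, δ, hA, hδ, H⟩ := exists_ball_lower_bound d k hρ hρ1
  refine ⟨2 * A, δ, by linarith, hδ, fun p hp x₀ h hh => ?_⟩
  obtain ⟨y, hy, hmax⟩ := (isCompact_closedBall x₀ (3 * h)).exists_isMaxOn
    (nonempty_closedBall.2 (by positivity))
    (continuous_norm.comp (continuous_fderiv_of_mem_polySpace hp)).continuousOn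
  -- a direction in which the largest derivative is at least half its norm
  obtain ⟨e, he, hey⟩ : ∃ e : Space d, ‖e‖ ≤ 1 ∧ ‖fderiv ℝ p y‖ ≤ 2 * |fderiv ℝ p y e| := by
    rcases eq_or_ne (fderiv ℝ p y) 0 with h0 | h0
    · exact ⟨0, by simp, by simp [h0]⟩
    · obtain ⟨e, he, h1⟩ := (fderiv ℝ p y).exists_lt_apply_of_lt_opNorm
        (half_lt_self (norm_pos_iff.2 h0))
      exact ⟨e, he.le, by rw [Real.norm_eq_abs] at h1; linarith⟩
  obtain ⟨M, hM, ⟨y₀, hsub, hlow⟩, hup⟩ := H _ (fderiv_apply_mem_polySpace hp e) x₀ h hh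
  refine ⟨M, hM, ⟨y₀, hsub, fun x hx => (hlow x hx).trans ?_⟩, fun x hx => ?_⟩
  · rw [← Real.norm_eq_abs]
    exact (ContinuousLinearMap.le_opNorm _ _).trans (mul_le_of_le_one_right (norm_nonneg _) he)
  · have h1 : ‖fderiv ℝ p x‖ ≤ ‖fderiv ℝ p y‖ := hmax hx
    have h2 := (hup y hy).1
    linarith

end Polynomials

/-! ### Barycentric coordinates and Lagrange interpolation on a simplex -/

section Barycentric

variable {d : ℕ} {s : Finset (Space d)}

/-- A full-dimensional simplex: `d + 1` affinely independent vertices. -/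
def IsFullSimplex (s : Finset (Space d)) : Prop :=
  AffineIndependent ℝ ((↑) : s → Space d) ∧ s.card = d + 1

lemma IsFullSimplex.affineSpan_eq_top (hs : IsFullSimplex s) :
    affineSpan ℝ (range ((↑) : s → Space d)) = ⊤ := by
  rw [hs.1.affineSpan_eq_top_iff_card_eq_finrank_add_one]
  simp [hs.2]

/-- The affine basis formed by the vertices of a full-dimensional simplex. -/
noncomputable def IsFullSimplex.basis (hs : IsFullSimplex s) : AffineBasis s ℝ (Space d) :=
  ⟨(↑), hs.1, hs.affineSpan_eq_top⟩

lemma IsFullSimplex.bary_eq (hs : IsFullSimplex s) {a : Space d} (ha : a ∈ s) (x : Space d) :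
    bary s a x = hs.basis.coord ⟨a, ha⟩ x := by
  rw [bary, dif_pos ⟨ha, hs.1, hs.affineSpan_eq_top⟩]
  rfl

lemma bary_of_notMem {a : Space d} (ha : a ∉ s) (x : Space d) : bary s a x = 0 := by
  rw [bary, dif_neg (fun h => ha h.1)]

lemma IsFullSimplex.sum_bary (hs : IsFullSimplex s) (x : Space d) :
    ∑ a ∈ s, bary s a x = 1 := by
  rw [← Finset.sum_coe_sort, ← hs.basis.sum_coord_apply_eq_one x]
  exact Finset.sum_congr rfl fun a _ => hs.bary_eq a.2 x

lemma IsFullSimplex.bary_sum_smul (hs : IsFullSimplex s) {w : Space d → ℝ}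
    (hw : ∑ a ∈ s, w a = 1) {a : Space d} (ha : a ∈ s) :
    bary s a (∑ b ∈ s, w b • b) = w a := by
  have hw' : ∑ b : s, w b = 1 := by rw [Finset.sum_coe_sort s w]; exact hw
  have := hs.basis.coord_apply_combination_of_mem (s := Finset.univ) (i := ⟨a, ha⟩)
    (Finset.mem_univ _) (w := fun b => w b) hw'
  rw [hs.bary_eq ha, ← Finset.sum_coe_sort s (fun b => w b • b)]
  rw [Finset.affineCombination_eq_linear_combination _ _ _ hw'] at this
  exact this

lemma IsFullSimplex.range_basis (hs : IsFullSimplex s) : range hs.basis = (s : Set (Space d)) :=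
  Subtype.range_coe

lemma IsFullSimplex.mem_simplex_iff (hs : IsFullSimplex s) {x : Space d} :
    x ∈ simplex s ↔ ∀ a ∈ s, 0 ≤ bary s a x := by
  rw [simplex, ← hs.range_basis, hs.basis.convexHull_eq_nonneg_coord]
  exact ⟨fun h a ha => by rw [hs.bary_eq ha]; exact h _, fun h a => by
    rw [← hs.bary_eq a.2]; exact h _ a.2⟩

lemma IsFullSimplex.mem_interior_iff (hs : IsFullSimplex s) {x : Space d} :
    x ∈ interior (simplex s) ↔ ∀ a ∈ s, 0 < bary s a x := by
  rw [simplex, ← hs.range_basis, hs.basis.interior_convexHull]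
  exact ⟨fun h a ha => by rw [hs.bary_eq ha]; exact h _, fun h a => by
    rw [← hs.bary_eq a.2]; exact h _ a.2⟩

lemma IsFullSimplex.bary_nonneg (hs : IsFullSimplex s) {x : Space d} (hx : x ∈ simplex s)
    (a : Space d) : 0 ≤ bary s a x := by
  by_cases ha : a ∈ s
  · exact hs.mem_simplex_iff.1 hx a ha
  · rw [bary_of_notMem ha]

lemma IsFullSimplex.bary_le_one (hs : IsFullSimplex s) {x : Space d} (hx : x ∈ simplex s)
    (a : Space d) : bary s a x ≤ 1 := by
  by_cases ha : a ∈ s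
  · rw [← hs.sum_bary x]
    exact Finset.single_le_sum (fun b _ => hs.bary_nonneg hx b) ha
  · rw [bary_of_notMem ha]; exact zero_le_one

lemma IsFullSimplex.exists_linear (hs : IsFullSimplex s) (a : Space d) :
    ∃ l : Space d →ₗ[ℝ] ℝ, ∀ x y, bary s a x - bary s a y = l (x - y) := by
  by_cases ha : a ∈ s
  · refine ⟨(hs.basis.coord ⟨a, ha⟩).linear, fun x y => ?_⟩
    rw [hs.bary_eq ha, hs.bary_eq ha]
    exact ((hs.basis.coord ⟨a, ha⟩).linearMap_vsub x y).symm
  · exact ⟨0, fun x y => by simp [bary_of_notMem ha]⟩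

/-- A simplex that contains a ball of radius `r` has barycentric coordinates with Lipschitz
constant `1 / r`. -/
lemma IsFullSimplex.abs_bary_sub_le (hs : IsFullSimplex s) {x₀ : Space d} {r : ℝ} (hr : 0 < r)
    (hball : closedBall x₀ r ⊆ simplex s) (a x y : Space d) :
    |bary s a x - bary s a y| ≤ 1 / r * ‖x - y‖ := by
  obtain ⟨l, hl⟩ := hs.exists_linear a
  rw [hl]
  rcases eq_or_ne (x - y) 0 with h0 | h0
  · simp [h0]
  · have hn : 0 < ‖x - y‖ := norm_pos_iff.2 h0
    have hmem : x₀ + (r / ‖x - y‖) • (x - y) ∈ simplex s := hball (by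
      rw [mem_closedBall, dist_eq_norm, add_sub_cancel_left, norm_smul,
        Real.norm_of_nonneg (by positivity), div_mul_cancel₀ _ hn.ne'])
    have hmem₀ : x₀ ∈ simplex s := hball (mem_closedBall_self hr.le)
    have h1 := hl (x₀ + (r / ‖x - y‖) • (x - y)) x₀
    rw [add_sub_cancel_left, map_smul, smul_eq_mul] at h1
    have h2 : |r / ‖x - y‖ * l (x - y)| ≤ 1 := by
      rw [← h1, abs_le]
      constructor <;> linarith [hs.bary_nonneg hmem a, hs.bary_nonneg hmem₀ a,
        hs.bary_le_one hmem a, hs.bary_le_one hmem₀ a]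
    rw [abs_mul, abs_of_pos (by positivity), div_mul_eq_mul_div, div_le_one hn] at h2
    rw [div_mul_eq_mul_div, one_mul, le_div_iff₀ hr]
    linarith

lemma IsFullSimplex.bary_mem_polySpace (hs : IsFullSimplex s) (a : Space d) :
    bary s a ∈ polySpace d 1 := by
  obtain ⟨l, hl⟩ := hs.exists_linear a
  have : bary s a = fun x => (∑ i, l (EuclideanSpace.single i 1) * x i) + bary s a 0 := by
    funext x
    have h1 := hl x 0
    rw [sub_zero] at h1
    have h2 : x = ∑ i, x i • EuclideanSpace.single i (1 : ℝ) := by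
      conv_lhs => rw [← (EuclideanSpace.basisFun (Fin d) ℝ).sum_repr x]
      simp
    have h3 : l x = ∑ i, l (EuclideanSpace.single i 1) * x i := by
      conv_lhs => rw [h2, map_sum]
      simp [mul_comm]
    linarith
  rw [this]
  exact add_mem_polySpace (sum_mem_polySpace _ fun i _ =>
    const_mul_mem_polySpace _ (coord_mem_polySpace i)) (const_mem_polySpace _ _)

lemma mem_nodeIndices {k : ℕ} {α : Space d → ℕ} :
    α ∈ nodeIndices k s ↔ ∑ a ∈ s, α a = k ∧ ∀ a, α a ≠ 0 → a ∈ s := by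
  classical
  rw [nodeIndices]
  exact Finset.mem_piAntidiag

lemma sum_nodeIndex_div {k : ℕ} (hk : 1 ≤ k) {α : Space d → ℕ} (hα : α ∈ nodeIndices k s) :
    ∑ a ∈ s, (α a : ℝ) / k = 1 := by
  rw [← Finset.sum_div, ← Nat.cast_sum, (mem_nodeIndices.1 hα).1, div_self]
  positivity

lemma IsFullSimplex.bary_node (hs : IsFullSimplex s) {k : ℕ} (hk : 1 ≤ k) {α : Space d → ℕ}
    (hα : α ∈ nodeIndices k s) {a : Space d} (ha : a ∈ s) :
    bary s a (node k s α) = α a / k :=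
  hs.bary_sum_smul (w := fun b => (α b : ℝ) / k) (sum_nodeIndex_div hk hα) ha

lemma IsFullSimplex.node_mem (hs : IsFullSimplex s) {k : ℕ} (hk : 1 ≤ k) {α : Space d → ℕ}
    (hα : α ∈ nodeIndices k s) : node k s α ∈ simplex s :=
  hs.mem_simplex_iff.2 fun a ha => by rw [hs.bary_node hk hα ha]; positivity

lemma IsFullSimplex.localBasis_node_self (hs : IsFullSimplex s) {k : ℕ} (hk : 1 ≤ k)
    {α : Space d → ℕ} (hα : α ∈ nodeIndices k s) : localBasis k s α (node k s α) = 1 := by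
  refine Finset.prod_eq_one fun a ha => ?_
  rw [hs.bary_node hk hα ha, mul_div_cancel₀ _ (by positivity), Finset.prod_div_distrib,
    div_eq_one_iff_eq (Finset.prod_ne_zero_iff.2 fun i _ => by positivity),
    ← Finset.prod_range_reflect]
  refine Finset.prod_congr rfl fun i hi => ?_
  rw [Finset.mem_range] at hi
  rw [Nat.sub_sub, Nat.cast_sub (by omega)]
  push_cast
  ring

lemma IsFullSimplex.localBasis_node_of_ne (hs : IsFullSimplex s) {k : ℕ} (hk : 1 ≤ k)
    {α β : Space d → ℕ} (hα : α ∈ nodeIndices k s) (hβ : β ∈ nodeIndices k s) (hne : α ≠ β) :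
    localBasis k s α (node k s β) = 0 := by
  rw [mem_nodeIndices] at hα
  obtain ⟨hβ1, hβ2⟩ := mem_nodeIndices.1 hβ
  -- since both indices have the same length, some component of `α` exceeds that of `β`
  obtain ⟨a, ha, hlt⟩ : ∃ a ∈ s, β a < α a := by
    by_contra! hle
    have := (Finset.sum_eq_sum_iff_of_le hle).1 (hα.1.trans hβ1.symm)
    refine hne (funext fun a => ?_)
    by_cases ha : a ∈ s
    · exact this a ha
    · rw [not_imp_comm.1 (hα.2 a) ha, not_imp_comm.1 (hβ2 a) ha]
  refine Finset.prod_eq_zero ha (Finset.prod_eq_zero (Finset.mem_range.2 hlt) ?_)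
  rw [hs.bary_node hk hβ ha, mul_div_cancel₀ _ (by positivity), sub_self, zero_div]

lemma IsFullSimplex.localBasis_mem_polySpace (hs : IsFullSimplex s) {k : ℕ} {α : Space d → ℕ}
    (hα : α ∈ nodeIndices k s) : localBasis k s α ∈ polySpace d k := by
  have h1 : (fun x => ∏ a ∈ s, ∏ i ∈ Finset.range (α a),
      (((i : ℝ) + 1)⁻¹ * (k * bary s a x + -i))) ∈
        polySpace d (∑ a ∈ s, ∑ _i ∈ Finset.range (α a), 1) :=
    prod_mem_polySpace _ fun a _ => prod_mem_polySpace _ fun i _ =>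
      const_mul_mem_polySpace _ (add_mem_polySpace
        (const_mul_mem_polySpace _ (hs.bary_mem_polySpace a)) (const_mem_polySpace _ _))
  simp only [Finset.sum_const, Finset.card_range, smul_eq_mul, mul_one,
    (mem_nodeIndices.1 hα).1] at h1
  convert h1 using 1
  funext x
  exact Finset.prod_congr rfl fun a _ => Finset.prod_congr rfl fun i _ => by
    rw [div_eq_inv_mul, sub_eq_add_neg]

lemma IsFullSimplex.abs_localBasis_le (hs : IsFullSimplex s) {k : ℕ} {α : Space d → ℕ}
    (hα : α ∈ nodeIndices k s) {x : Space d} (hx : x ∈ simplex s) :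
    |localBasis k s α x| ≤ (k : ℝ) ^ k := by
  rw [localBasis, Finset.abs_prod]
  calc ∏ a ∈ s, |∏ i ∈ Finset.range (α a), ((k : ℝ) * bary s a x - i) / ((i : ℝ) + 1)|
      ≤ ∏ a ∈ s, (k : ℝ) ^ α a := by
        refine Finset.prod_le_prod (fun _ _ => abs_nonneg _) fun a ha => ?_
        rw [Finset.abs_prod]
        refine (Finset.prod_le_prod (g := fun _ => (k : ℝ)) (fun _ _ => abs_nonneg _)
          fun i hi => ?_).trans_eq (by simp)
        have hαk : α a ≤ k := (mem_nodeIndices.1 hα).1 ▸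
          Finset.single_le_sum (f := α) (fun _ _ => Nat.zero_le _) ha
        have hik : (i : ℝ) ≤ k := by exact_mod_cast ((Finset.mem_range.1 hi).le.trans hαk)
        have h0 := hs.bary_nonneg hx a
        have h1 := hs.bary_le_one hx a
        have hk0 : (0 : ℝ) ≤ k := k.cast_nonneg
        have hi0 : (0 : ℝ) ≤ i := i.cast_nonneg
        have h2 : (k : ℝ) * bary s a x ≤ k := mul_le_of_le_one_right hk0 h1
        have h3 : 0 ≤ (k : ℝ) * bary s a x := mul_nonneg hk0 h0
        rw [abs_div, abs_of_pos (by positivity : (0 : ℝ) < i + 1), div_le_iff₀ (by positivity)]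
        refine (abs_le.2 ⟨?_, ?_⟩ : _ ≤ (k : ℝ)).trans (le_mul_of_one_le_right hk0 (by linarith))
        · linarith
        · linarith
    _ = (k : ℝ) ^ k := by rw [Finset.prod_pow_eq_pow_sum, (mem_nodeIndices.1 hα).1]

/-- Exponents of monomials of degree at most `k` in `d` variables inject into the multi-indices of
length `k` on `d + 1` vertices: the last component is the missing degree. -/
lemma finrank_restrictTotalDegree_le (k : ℕ) (hs : s.card = d + 1) :
    Module.finrank ℝ (MvPolynomial.restrictTotalDegree (Fin d) ℝ k) ≤
      (nodeIndices k s).card := by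
  classical
  have hcard : Module.finrank ℝ (MvPolynomial.restrictTotalDegree (Fin d) ℝ k) =
      Nat.card {n : Fin d →₀ ℕ | n.sum (fun _ e ↦ e) ≤ k} :=
    Module.finrank_eq_nat_card_basis
      (MvPolynomial.basisRestrictSupport ℝ {n : Fin d →₀ ℕ | n.sum (fun _ e ↦ e) ≤ k})
  rw [hcard, ← Nat.card_eq_finsetCard]
  let e : s ≃ Fin (d + 1) := Finset.equivFinOfCardEq hs
  let g : (Fin d →₀ ℕ) → Space d → ℕ := fun n a =>
    if h : a ∈ s then (Fin.snoc (n : Fin d → ℕ) (k - ∑ i, n i) : Fin (d + 1) → ℕ) (e ⟨a, h⟩) else 0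
  refine Nat.card_le_card_of_injective
    (fun n : {n : Fin d →₀ ℕ | n.sum (fun _ e ↦ e) ≤ k} => (⟨g n, ?_⟩ : nodeIndices k s)) ?_
  · have hn : ∑ i, (n : Fin d →₀ ℕ) i ≤ k := by
      have := n.2
      rwa [Set.mem_ofPred_eq, Finsupp.sum_fintype _ _ (fun _ => rfl)] at this
    refine mem_nodeIndices.2 ⟨?_, fun a ha => ?_⟩
    · rw [← Finset.sum_coe_sort]
      have : ∀ a : s, g n a =
          (Fin.snoc (n : Fin d → ℕ) (k - ∑ i, (n : Fin d →₀ ℕ) i) : Fin (d + 1) → ℕ) (e a) :=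
        fun a => dif_pos a.2
      simp only [this]
      rw [e.sum_comp (Fin.snoc (n : Fin d → ℕ) (k - ∑ i, (n : Fin d →₀ ℕ) i) : Fin (d + 1) → ℕ),
        Fin.sum_univ_castSucc]
      simp
      omega
    · by_contra h
      exact ha (dif_neg h)
  · intro n n' hnn
    refine Subtype.ext (Finsupp.ext fun i => ?_)
    have h1 : g n (e.symm i.castSucc) = g n' (e.symm i.castSucc) :=
      congrFun (Subtype.ext_iff.1 hnn) _
    simpa [g] using h1

/-- Unisolvence of the equispaced nodes: Lagrange interpolation of degree `k` reproduces
polynomials of degree at most `k`. -/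
lemma IsFullSimplex.eq_sum_localBasis (hs : IsFullSimplex s) {k : ℕ} (hk : 1 ≤ k)
    {f : Space d → ℝ} (hf : f ∈ polySpace d k) (x : Space d) :
    f x = ∑ α ∈ nodeIndices k s, f (node k s α) * localBasis k s α x := by
  let V := MvPolynomial.restrictTotalDegree (Fin d) ℝ k
  let E : V →ₗ[ℝ] (nodeIndices k s → ℝ) :=
    LinearMap.pi fun α =>
      (MvPolynomial.aeval (fun i => (node k s α) i) : MvPolynomial (Fin d) ℝ →ₐ[ℝ] ℝ).toLinearMap
        ∘ₗ V.subtype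
  have hE : ∀ (p : V) (α : nodeIndices k s),
      E p α = MvPolynomial.eval (fun i => (node k s α) i) (p : MvPolynomial (Fin d) ℝ) :=
    fun p α => by simp [E, MvPolynomial.aeval_eq_eval]
  -- every assignment of nodal values is attained by the interpolating polynomial
  have hinterp : ∀ w : nodeIndices k s → ℝ,
      (fun y => ∑ α : nodeIndices k s, w α * localBasis k s α y) ∈ polySpace d k := fun w =>
    sum_mem_polySpace _ fun α _ => const_mul_mem_polySpace _ (hs.localBasis_mem_polySpace α.2)
  have hnode : ∀ (w : nodeIndices k s → ℝ) (β : nodeIndices k s),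
      ∑ α : nodeIndices k s, w α * localBasis k s α (node k s β) = w β := fun w β => by
    rw [Finset.sum_eq_single β, hs.localBasis_node_self hk β.2, mul_one]
    · intro α _ hne
      rw [hs.localBasis_node_of_ne hk α.2 β.2 (fun h => hne (Subtype.ext h)), mul_zero]
    · simp
  have hsurj : Function.Surjective E := fun w => by
    obtain ⟨p, hp, hpe⟩ := hinterp w
    refine ⟨⟨p, (MvPolynomial.mem_restrictTotalDegree _ _ _).2 hp⟩, funext fun β => ?_⟩
    rw [hE, ← hpe]
    exact hnode w β
  have hfin : Module.finrank ℝ V = Module.finrank ℝ (nodeIndices k s → ℝ) := by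
    refine le_antisymm ?_ (LinearMap.finrank_le_finrank_of_surjective hsurj)
    simpa using finrank_restrictTotalDegree_le k hs.2
  have hinj : Function.Injective E :=
    (LinearMap.injective_iff_surjective_of_finrank_eq_finrank hfin).2 hsurj
  obtain ⟨p, hp, hpe⟩ := hf
  obtain ⟨r, hr, hre⟩ := hinterp fun α => f (node k s α)
  have hpr : (⟨p, (MvPolynomial.mem_restrictTotalDegree _ _ _).2 hp⟩ : V) =
      ⟨r, (MvPolynomial.mem_restrictTotalDegree _ _ _).2 hr⟩ := by
    refine hinj (funext fun β => ?_)
    rw [hE, hE, ← hpe, ← hre]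
    exact (hnode (fun α => f (node k s α)) β).symm
  have hpr' : p = r := Subtype.ext_iff.1 hpr
  rw [hpe, hpr', ← hre]
  exact Finset.sum_coe_sort _ fun α => f (node k s α) * localBasis k s α x

end Barycentric

/-! ### Conforming triangulations and the Oswald operator -/

section Triangulations

variable {d : ℕ} {Ω : Set (Space d)} {K : Triangulation d Ω} {s t : Finset (Space d)}

lemma isCompact_simplex (s : Finset (Space d)) : IsCompact (simplex s) :=
  s.finite_toSet.isCompact_convexHull ℝ

lemma mem_elements : s ∈ K.elements ↔ s ∈ K.faces ∧ s.card = d + 1 := by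
  simp [Triangulation.elements]

lemma nonempty_of_mem_elements (hs : s ∈ K.elements) : s.Nonempty :=
  Finset.card_pos.1 (by rw [(mem_elements.1 hs).2]; exact Nat.succ_pos d)

lemma isFullSimplex_of_mem (hs : s ∈ K.elements) : IsFullSimplex s :=
  ⟨K.indep (mem_elements.1 hs).1, (mem_elements.1 hs).2⟩

lemma simplex_subset_of_mem_faces (hs : s ∈ K.faces) : simplex s ⊆ Ω := by
  have := K.toSimplicialComplex.convexHull_subset_space hs
  rwa [K.space_eq] at this

lemma simplex_subset (hs : s ∈ K.elements) : simplex s ⊆ Ω :=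
  simplex_subset_of_mem_faces (mem_elements.1 hs).1

variable (K) in
lemma exists_face_of_mem {x : Space d} (hx : x ∈ Ω) : ∃ s ∈ K.faces, x ∈ simplex s := by
  rw [← K.space_eq] at hx
  exact Geometry.SimplicialComplex.mem_space_iff.1 hx

variable (K) in
lemma exists_element_of_mem {x : Space d} (hx : x ∈ Ω) : ∃ s ∈ K.elements, x ∈ simplex s := by
  obtain ⟨s, hs, hxs⟩ := exists_face_of_mem K hx
  obtain ⟨t, ht, hst, hc⟩ := K.pure s hs
  exact ⟨t, mem_elements.2 ⟨ht, hc⟩, convexHull_mono (Finset.coe_subset.2 hst) hxs⟩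

variable (K) in
lemma domain_eq_biUnion : Ω = ⋃ s ∈ K.elements, simplex s := by
  ext x
  simp only [mem_iUnion, exists_prop]
  exact ⟨fun hx => exists_element_of_mem K hx, fun ⟨s, hs, hx⟩ => simplex_subset hs hx⟩

/-- A point common to two elements has its barycentric weights on the common vertices only. -/
lemma bary_of_mem_of_mem (hs : s ∈ K.elements) (ht : t ∈ K.elements) {x : Space d}
    (hxs : x ∈ simplex s) (hxt : x ∈ simplex t) (a : Space d) :
    bary s a x = bary t a x ∧ (a ∉ t → bary s a x = 0) := by
  classical
  have hx := K.inter_subset_convexHull (mem_elements.1 hs).1 (mem_elements.1 ht).1 ⟨hxs, hxt⟩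
  rw [← Finset.coe_inter, Finset.mem_convexHull'] at hx
  obtain ⟨w, -, hw1, hwx⟩ := hx
  have key : ∀ u ∈ K.elements, s ∩ t ⊆ u → bary u a x = if a ∈ s ∩ t then w a else 0 := by
    intro u hu hsub
    by_cases ha : a ∈ u
    · have h1 : ∑ b ∈ u, (if b ∈ s ∩ t then w b else 0) = 1 := by
        rw [← hw1, ← Finset.sum_filter, Finset.filter_mem_eq_inter,
          Finset.inter_eq_right.2 hsub]
      have h2 : ∑ b ∈ u, (if b ∈ s ∩ t then w b else 0) • b = x := by
        simp only [ite_smul, zero_smul]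
        rw [← hwx, ← Finset.sum_filter, Finset.filter_mem_eq_inter,
          Finset.inter_eq_right.2 hsub]
      have := (isFullSimplex_of_mem hu).bary_sum_smul h1 ha
      rwa [h2] at this
    · rw [bary_of_notMem ha, if_neg fun h => ha (hsub h)]
  refine ⟨by rw [key s hs Finset.inter_subset_left, key t ht Finset.inter_subset_right],
    fun ha => ?_⟩
  rw [key s hs Finset.inter_subset_left, if_neg fun h => ha (Finset.mem_inter.1 h).2]

lemma eq_of_mem_interior (hs : s ∈ K.elements) (ht : t ∈ K.elements) {x : Space d}
    (hxs : x ∈ interior (simplex s)) (hxt : x ∈ simplex t) : s = t := by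
  refine Finset.eq_of_subset_of_card_le (fun a ha => ?_)
    ((mem_elements.1 hs).2.trans (mem_elements.1 ht).2.symm).ge
  by_contra hat
  exact ((isFullSimplex_of_mem hs).mem_interior_iff.1 hxs a ha).ne'
    ((bary_of_mem_of_mem hs ht (interior_subset hxs) hxt a).2 hat)

lemma exists_common_vertex (hs : s ∈ K.elements) (ht : t ∈ K.elements) {x : Space d}
    (hxs : x ∈ simplex s) (hxt : x ∈ simplex t) : ∃ a ∈ s, a ∈ t := by
  by_contra! h
  have h1 := (isFullSimplex_of_mem hs).sum_bary x
  rw [Finset.sum_eq_zero fun a ha => (bary_of_mem_of_mem hs ht hxs hxt a).2 (h a ha)] at h1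
  exact zero_ne_one h1

/-- The sum of the local basis functions whose node is `p` takes the same value for every element
that contains the given point. -/
lemma sum_localBasis_eq (hs : s ∈ K.elements) (ht : t ∈ K.elements) {k : ℕ} {x : Space d}
    (hxs : x ∈ simplex s) (hxt : x ∈ simplex t) (p : Space d) [DecidableEq (Space d)] :
    ∑ α ∈ (nodeIndices k s).filter (fun α => node k s α = p), localBasis k s α x =
      ∑ α ∈ (nodeIndices k t).filter (fun α => node k t α = p), localBasis k t α x := by
  -- indices that are not supported on the common face contribute zero
  have hzero : ∀ s' ∈ K.elements, ∀ t' ∈ K.elements, x ∈ simplex s' → x ∈ simplex t' →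
      ∀ α ∈ nodeIndices k s', α ∉ nodeIndices k t' → localBasis k s' α x = 0 := by
    intro s' hs' t' ht' hx hx' α hα hα'
    obtain ⟨h1, h2⟩ := mem_nodeIndices.1 hα
    obtain ⟨a, ha0, hat⟩ : ∃ a, α a ≠ 0 ∧ a ∉ t' := by
      by_contra! hcon
      refine hα' (mem_nodeIndices.2 ⟨?_, hcon⟩)
      rw [← h1]
      exact Finset.sum_congr_of_eq_on_inter (fun a _ ha => not_imp_comm.1 (h2 a) ha)
        (fun a _ ha => not_imp_comm.1 (hcon a) ha) fun _ _ _ => rfl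
    refine Finset.prod_eq_zero (h2 a ha0) (Finset.prod_eq_zero
      (Finset.mem_range.2 (Nat.pos_of_ne_zero ha0)) ?_)
    rw [(bary_of_mem_of_mem hs' ht' hx hx' a).2 hat]
    simp
  have hnode : ∀ α ∈ nodeIndices k s, α ∈ nodeIndices k t → node k s α = node k t α := by
    intro α hα hα'
    refine Finset.sum_congr_of_eq_on_inter (fun a _ ha => ?_) (fun a _ ha => ?_) fun _ _ _ => rfl
    · simp [not_imp_comm.1 ((mem_nodeIndices.1 hα').2 a) ha]
    · simp [not_imp_comm.1 ((mem_nodeIndices.1 hα).2 a) ha]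
  have hbasis : ∀ α ∈ nodeIndices k s, α ∈ nodeIndices k t →
      localBasis k s α x = localBasis k t α x := by
    intro α hα hα'
    refine Finset.prod_congr_of_eq_on_inter (fun a _ ha => ?_) (fun a _ ha => ?_) fun a _ _ => ?_
    · simp [not_imp_comm.1 ((mem_nodeIndices.1 hα').2 a) ha]
    · simp [not_imp_comm.1 ((mem_nodeIndices.1 hα).2 a) ha]
    · rw [(bary_of_mem_of_mem hs ht hxs hxt a).1]
  refine Finset.sum_congr_of_eq_on_inter (fun α hα hα' => ?_) (fun α hα hα' => ?_)
    fun α hα hα' => hbasis α (Finset.mem_filter.1 hα).1 (Finset.mem_filter.1 hα').1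
  · obtain ⟨h1, h2⟩ := Finset.mem_filter.1 hα
    exact hzero s hs t ht hxs hxt α h1 fun h3 =>
      hα' (Finset.mem_filter.2 ⟨h3, (hnode α h1 h3).symm.trans h2⟩)
  · obtain ⟨h1, h2⟩ := Finset.mem_filter.1 hα
    exact hzero t ht s hs hxt hxs α h1 fun h3 =>
      hα' (Finset.mem_filter.2 ⟨h3, (hnode α h3 h1).trans h2⟩)

lemma globalBasis_eq (hs : s ∈ K.elements) {k : ℕ} {x : Space d} (hx : x ∈ simplex s)
    (p : Space d) [DecidableEq (Space d)] :
    globalBasis K k p x =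
      ∑ α ∈ (nodeIndices k s).filter (fun α => node k s α = p), localBasis k s α x := by
  have h : ∃ s ∈ K.elements, x ∈ simplex s := ⟨s, hs, hx⟩
  rw [globalBasis, dif_pos h]
  rw [← sum_localBasis_eq h.choose_spec.1 hs h.choose_spec.2 hx p]
  refine Finset.sum_congr (Finset.ext fun α => ?_) fun _ _ => rfl
  simp only [Finset.mem_filter]

/-- The average of the elementwise values of `g` at the point `p`. -/
noncomputable def nodalAverage (K : Triangulation d Ω) (g : Finset (Space d) → Space d → ℝ)
    (p : Space d) : ℝ :=
  ((elementsAt K p).card : ℝ)⁻¹ * ∑ s ∈ elementsAt K p, g s p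

lemma mem_elementsAt {p : Space d} : s ∈ elementsAt K p ↔ s ∈ K.elements ∧ p ∈ simplex s := by
  simp [elementsAt]

lemma oswald_eq (hs : s ∈ K.elements) {k : ℕ} {x : Space d} (hx : x ∈ simplex s)
    (g : Finset (Space d) → Space d → ℝ) :
    oswald K k g x =
      ∑ α ∈ nodeIndices k s, nodalAverage K g (node k s α) * localBasis k s α x := by
  classical
  have hmaps : ∀ α ∈ nodeIndices k s, node k s α ∈ nodes K k := fun α hα => by
    rw [nodes]
    refine Finset.mem_biUnion.2 ⟨s, hs, ?_⟩
    exact Finset.mem_image_of_mem _ hα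
  rw [oswald, ← Finset.sum_fiberwise_of_maps_to hmaps]
  refine Finset.sum_congr rfl fun p _ => ?_
  rw [globalBasis_eq hs hx, Finset.mul_sum]
  refine Finset.sum_congr rfl fun α hα => ?_
  rw [(Finset.mem_filter.1 hα).2, nodalAverage]

lemma continuousOn_domain {f : Space d → ℝ}
    (hf : ∀ s ∈ K.elements, ContinuousOn f (simplex s)) : ContinuousOn f Ω := by
  have hΩ : Ω = ⋃ s : K.elements, simplex (s : Finset (Space d)) :=
    (domain_eq_biUnion K).trans (iUnion_subtype (· ∈ K.elements) (fun s => simplex s.1)).symm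
  rw [hΩ]
  exact (locallyFinite_of_finite _).continuousOn_iUnion
    (fun s => (isCompact_simplex _).isClosed) fun s => hf _ s.2

lemma oswald_mem_feSpace (K : Triangulation d Ω) (k : ℕ)
    (g : Finset (Space d) → Space d → ℝ) : oswald K k g ∈ feSpace K k := by
  have h : ∀ s ∈ K.elements, ∃ p ∈ polySpace d k, EqOn (oswald K k g) p (simplex s) :=
    fun s hs => ⟨_, sum_mem_polySpace _ fun α hα => const_mul_mem_polySpace _
      ((isFullSimplex_of_mem hs).localBasis_mem_polySpace hα), fun x hx => oswald_eq hs hx g⟩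
  refine ⟨continuousOn_domain (K := K) fun s hs => ?_, h⟩
  obtain ⟨p, hp, hpe⟩ := h s hs
  exact (differentiable_of_mem_polySpace hp).continuous.continuousOn.congr hpe

lemma subset_enlarge {S : Set (Finset (Space d))} (hS : S ⊆ ↑K.elements) :
    S ⊆ enlarge K S := fun s hs => by
  obtain ⟨a, ha⟩ := nonempty_of_mem_elements (hS hs)
  exact ⟨hS hs, s, hs, a, ha, ha⟩

lemma mem_enlarge_singleton :
    t ∈ enlarge K {s} ↔ t ∈ K.elements ∧ ∃ a ∈ s, a ∈ t := by
  simp [enlarge]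

lemma patch_eq_enlarge {Θ : Space d → Space d} (hΘ : InjOn Θ Ω) (hs : s ∈ K.elements) :
    patch K Θ s = enlarge K {s} := by
  ext t
  rw [mem_enlarge_singleton]
  refine and_congr_right fun ht => ⟨?_, ?_⟩
  · rintro ⟨_, ⟨x, hx, rfl⟩, ⟨y, hy, hxy⟩⟩
    rw [hΘ (simplex_subset ht hy) (simplex_subset hs hx) hxy] at hy
    exact exists_common_vertex hs ht hx hy
  · rintro ⟨a, has, hat⟩
    exact ⟨Θ a, mem_image_of_mem _ (subset_convexHull ℝ _ has),
      mem_image_of_mem _ (subset_convexHull ℝ _ hat)⟩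

/-- Volume comparison: in a quasi-uniform triangulation only boundedly many elements share a
vertex with a given one. -/
lemma card_enlarge_le {ρ h : ℝ} (hρ : 0 < ρ) (hK : K.IsQuasiUniform ρ h) (hs : s ∈ K.elements)
    (F : Finset (Finset (Space d))) (hF : (F : Set (Finset (Space d))) ⊆ enlarge K {s}) :
    (F.card : ℝ) ≤ (2 / ρ) ^ d := by
  obtain ⟨hh, hK⟩ := hK
  obtain ⟨a, ha⟩ := nonempty_of_mem_elements hs
  have hball : ∀ t : Finset (Space d), ∃ x, t ∈ K.elements → closedBall x (ρ * h) ⊆ simplex t :=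
    fun t => by
      by_cases ht : t ∈ K.elements
      · exact ((hK t ht).2).imp fun x hx _ => hx
      · exact ⟨0, fun h => absurd h ht⟩
  choose x hx using hball
  have hr : 0 < ρ * h := by positivity
  have hdist : ∀ t ∈ K.elements, ∀ u ∈ simplex t, ∀ v ∈ simplex t, dist u v ≤ h :=
    fun t ht u hu v hv =>
      (dist_le_diam_of_mem (isCompact_simplex t).isBounded hu hv).trans (hK t ht).1
  have hsub : (⋃ t ∈ F, ball (x t) (ρ * h)) ⊆ closedBall a (2 * h) := by
    refine iUnion₂_subset fun t ht y hy => ?_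
    obtain ⟨hte, b, hbs, hbt⟩ := mem_enlarge_singleton.1 (hF ht)
    have h1 := hdist t hte y (hx t hte (ball_subset_closedBall hy)) b (subset_convexHull ℝ _ hbt)
    have h2 := hdist s hs b (subset_convexHull ℝ _ hbs) a (subset_convexHull ℝ _ ha)
    rw [mem_closedBall]
    linarith [dist_triangle y b a]
  have hdisj : (F : Set (Finset (Space d))).PairwiseDisjoint fun t => ball (x t) (ρ * h) := by
    intro t ht t' ht' hne
    refine Set.disjoint_left.2 fun y hy hy' => hne ?_
    have hte := (hF ht).1
    have hte' := (hF ht').1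
    exact eq_of_mem_interior hte hte'
      (interior_maximal (ball_subset_closedBall.trans (hx t hte)) isOpen_ball hy)
      (hx t' hte' (ball_subset_closedBall hy'))
  have hvol := measure_mono (μ := (volume : Measure (Space d))) hsub
  rw [measure_biUnion_finset hdisj fun _ _ => measurableSet_ball,
    Measure.addHaar_closedBall _ _ (by positivity)] at hvol
  simp only [Measure.addHaar_ball_of_pos _ _ hr, Finset.sum_const, nsmul_eq_mul,
    finrank_euclideanSpace_fin] at hvol
  rw [← mul_assoc, ENNReal.mul_le_mul_iff_left (measure_ball_pos _ _ one_pos).ne'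
    measure_ball_lt_top.ne, ← ENNReal.ofReal_natCast, ← ENNReal.ofReal_mul (by positivity),
    ENNReal.ofReal_le_ofReal_iff (by positivity)] at hvol
  rw [mul_pow, mul_pow] at hvol
  rw [div_pow, le_div_iff₀ (by positivity)]
  have hhd : 0 < h ^ d := by positivity
  nlinarith

end Triangulations

/-! ### Short paths in the domain and in the mesh -/

section Paths

variable {d : ℕ} {Ω : Set (Space d)} {K : Triangulation d Ω} {s : Finset (Space d)}

/-- A function that is Lipschitz on each member of a finite closed cover of a segment is
Lipschitz along the segment. -/
lemma abs_sub_le_of_segment_subset {ι : Type*} {I : Finset ι} {A : ι → Set (Space d)}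
    (hA : ∀ i ∈ I, IsClosed (A i)) {f : Space d → ℝ} {c : ℝ}
    (hf : ∀ i ∈ I, ∀ u ∈ A i, ∀ v ∈ A i, |f u - f v| ≤ c * ‖u - v‖) {x y : Space d}
    (hcov : segment ℝ x y ⊆ ⋃ i ∈ I, A i) : |f x - f y| ≤ c * ‖x - y‖ := by
  let γ : ℝ → Space d := AffineMap.lineMap x y
  have hγ : Continuous γ := AffineMap.lineMap_continuous
  have hγd : ∀ τ τ' : ℝ, τ ≤ τ' → ‖γ τ' - γ τ‖ = (τ' - τ) * ‖x - y‖ := fun τ τ' hle => by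
    rw [← dist_eq_norm, dist_lineMap_lineMap, Real.dist_eq, abs_of_nonneg (sub_nonneg.2 hle),
      dist_eq_norm]
  have hγc : ∀ τ ∈ Icc (0 : ℝ) 1, ∃ i ∈ I, γ τ ∈ A i := fun τ hτ => by
    have : γ τ ∈ segment ℝ x y := by
      rw [segment_eq_image_lineMap]
      exact mem_image_of_mem _ hτ
    simpa using hcov this
  let B : Set ℝ := {τ | |f (γ τ) - f x| ≤ c * (τ * ‖x - y‖)}
  have hcont : ∀ i ∈ I, ContinuousOn f (A i) := fun i hi => by
    refine (LipschitzOnWith.of_dist_le_mul (K := c.toNNReal) fun u hu v hv => ?_).continuousOn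
    rw [Real.dist_eq, dist_eq_norm]
    refine (hf i hi u hu v hv).trans ?_
    gcongr
    exact Real.le_coe_toNNReal c
  have hclosed : IsClosed (B ∩ Icc 0 1) := by
    have : B ∩ Icc 0 1 = ⋃ i ∈ I, (Icc 0 1 ∩ γ ⁻¹' A i) ∩
        (fun τ => |f (γ τ) - f x| - c * (τ * ‖x - y‖)) ⁻¹' Iic 0 := by
      ext τ
      simp only [B, mem_inter_iff, mem_ofPred_eq, mem_iUnion, mem_preimage, mem_Iic, sub_nonpos,
        exists_prop]
      constructor
      · rintro ⟨h1, h2⟩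
        obtain ⟨i, hi, h3⟩ := hγc τ h2
        exact ⟨i, hi, ⟨h2, h3⟩, h1⟩
      · rintro ⟨i, hi, ⟨h2, h3⟩, h1⟩
        exact ⟨h1, h2⟩
    rw [this]
    refine isClosed_biUnion_finset fun i hi => ?_
    refine ContinuousOn.preimage_isClosed_of_isClosed ?_
      (isClosed_Icc.inter ((hA i hi).preimage hγ)) isClosed_Iic
    refine ContinuousOn.sub (ContinuousOn.abs (ContinuousOn.sub ?_ continuousOn_const))
      (by fun_prop)
    exact (hcont i hi).comp hγ.continuousOn fun τ hτ => hτ.2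
  have hB : Icc (0 : ℝ) 1 ⊆ B := by
    refine hclosed.Icc_subset_of_forall_exists_gt (by simp [B, γ]) fun τ hτ σ hσ => ?_
    by_contra hemp
    -- no member of the cover meets the segment just after `τ`
    have hev : ∀ i ∈ I, ∀ᶠ τ' in nhdsWithin τ (Ioi τ), γ τ' ∉ A i := by
      intro i hi
      by_cases hτi : γ τ ∈ A i
      · filter_upwards [Ioc_mem_nhdsGT (mem_Ioi.1 hσ)] with τ' hτ' hmem
        refine hemp ⟨τ', ?_, hτ'⟩
        have h1 := hf i hi _ hmem _ hτi
        rw [hγd τ τ' hτ'.1.le] at h1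
        have h2 : |f (γ τ) - f x| ≤ c * (τ * ‖x - y‖) := hτ.1
        have h3 := abs_sub_le (f (γ τ')) (f (γ τ)) (f x)
        change |f (γ τ') - f x| ≤ c * (τ' * ‖x - y‖)
        linarith
      · exact nhdsWithin_le_nhds
          (((hA i hi).isOpen_compl.preimage hγ).mem_nhds hτi)
    have hev' : ∀ᶠ τ' in nhdsWithin τ (Ioi τ), ∀ i ∈ I, γ τ' ∉ A i :=
      (Filter.eventually_all_finset I).2 hev
    obtain ⟨τ', h1, h2⟩ := (hev'.and (Ioc_mem_nhdsGT hτ.2.2)).exists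
    obtain ⟨i, hi, h3⟩ := hγc τ' ⟨hτ.2.1.trans h2.1.le, h2.2⟩
    exact h1 i hi h3
  have := hB (right_mem_Icc.2 zero_le_one)
  simpa [B, γ, abs_sub_comm] using this

/-- A triangulated domain is locally quasi-convex: nearby points are joined by a path of two
segments in the domain whose length is comparable to their distance. For points of two simplices,
subtracting the common part of the barycentric weights leaves points of disjoint faces, which have
positive distance. -/
lemma Triangulation.exists_quasiconvex (K : Triangulation d Ω) : ∃ L δ : ℝ, 0 ≤ L ∧ 0 < δ ∧
    ∀ x ∈ Ω, ∀ y ∈ Ω, ‖x - y‖ < δ → ∃ z, segment ℝ x z ⊆ Ω ∧ segment ℝ z y ⊆ Ω ∧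
      ‖x - z‖ ≤ L * ‖x - y‖ := by
  classical
  obtain ⟨δ, hδ, hdist⟩ : ∃ δ : ℝ, 0 < δ ∧ ∀ s ∈ K.faces, ∀ t ∈ K.faces, s ∩ t = ∅ →
      ∀ x ∈ simplex s, ∀ y ∈ simplex t, δ ≤ ‖x - y‖ := by
    have hpair : ∀ st : Finset (Space d) × Finset (Space d), ∃ r : ℝ, 0 < r ∧
        (st.1 ∈ K.faces → st.2 ∈ K.faces → st.1 ∩ st.2 = ∅ →
          ∀ x ∈ simplex st.1, ∀ y ∈ simplex st.2, r ≤ ‖x - y‖) := by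
      rintro ⟨s, t⟩
      by_cases h : s ∈ K.faces ∧ t ∈ K.faces ∧ s ∩ t = ∅
      · obtain ⟨hs, ht, hst⟩ := h
        have hdisj : Disjoint (simplex s) (simplex t) := by
          rw [Set.disjoint_iff]
          intro x hx
          have := K.inter_subset_convexHull hs ht hx
          rwa [← Finset.coe_inter, hst, Finset.coe_empty, convexHull_empty] at this
        obtain ⟨r, hr, h⟩ := hdisj.exists_thickenings (isCompact_simplex s)
          (isCompact_simplex t).isClosed
        refine ⟨r, hr, fun _ _ _ x hx y hy => ?_⟩
        by_contra! hlt
        refine Set.disjoint_left.1 h (self_subset_thickening hr _ hx)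
          (mem_thickening_iff.2 ⟨y, hy, by rwa [dist_eq_norm]⟩)
      · exact ⟨1, one_pos, fun h1 h2 h3 => absurd ⟨h1, h2, h3⟩ h⟩
    choose r hr hrd using hpair
    rcases (K.finite_faces.toFinset ×ˢ K.finite_faces.toFinset).eq_empty_or_nonempty with h0 | h0
    · refine ⟨1, one_pos, fun s hs t ht => ?_⟩
      have : (s, t) ∈ K.finite_faces.toFinset ×ˢ K.finite_faces.toFinset := by simp [hs, ht]
      simp [h0] at this
    · obtain ⟨st, -, hmin⟩ := Finset.exists_min_image _ r h0
      exact ⟨r st, hr st, fun s hs t ht hst x hx y hy =>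
        (hmin (s, t) (by simp [hs, ht])).trans (hrd (s, t) hs ht hst x hx y hy)⟩
  have hΩb : Bornology.IsBounded Ω := by
    rw [domain_eq_biUnion K]
    exact (Bornology.isBounded_biUnion_finset _).2 fun s _ => (isCompact_simplex s).isBounded
  obtain ⟨D, hD⟩ := hΩb.exists_norm_le
  have hD0 : ∀ x ∈ Ω, ∀ y ∈ Ω, ‖x - y‖ ≤ 2 * |D| := fun x hx y hy =>
    (norm_sub_le x y).trans (by linarith [hD x hx, hD y hy, le_abs_self D])
  refine ⟨2 * |D| / δ, δ, by positivity, hδ, fun x hx y hy hxy => ?_⟩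
  rcases eq_or_ne x y with rfl | hne
  · exact ⟨x, by simpa using hx, by simpa using hx, by simp⟩
  obtain ⟨s, hs, hxs⟩ := exists_face_of_mem K hx
  obtain ⟨t, ht, hyt⟩ := exists_face_of_mem K hy
  -- barycentric weights, extended by zero
  have hw : ∀ (s : Finset (Space d)) (x : Space d), x ∈ simplex s → ∃ w : Space d → ℝ,
      (∀ a, 0 ≤ w a) ∧ (∀ a ∉ s, w a = 0) ∧ ∑ a ∈ s, w a = 1 ∧ ∑ a ∈ s, w a • a = x := by
    intro s x hx
    obtain ⟨w, h0, h1, h2⟩ := Finset.mem_convexHull'.1 hx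
    refine ⟨fun a => if a ∈ s then w a else 0, fun a => ?_, fun a ha => if_neg ha, ?_, ?_⟩
    · dsimp only
      split_ifs with h
      exacts [h0 a h, le_rfl]
    · rw [← h1]
      exact Finset.sum_congr rfl fun a ha => if_pos ha
    · rw [← h2]
      exact Finset.sum_congr rfl fun a ha => by dsimp only; rw [if_pos ha]
  obtain ⟨w, hw0, hws, hw1, hwx⟩ := hw s x hxs
  obtain ⟨w', hw'0, hwt, hw'1, hwy⟩ := hw t y hyt
  let ν : Space d → ℝ := fun a => min (w a) (w' a)
  have hν0 : ∀ a, 0 ≤ ν a := fun a => le_min (hw0 a) (hw'0 a)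
  have hνs : ∀ a ∉ s, ν a = 0 := fun a ha =>
    le_antisymm ((min_le_left _ _).trans_eq (hws a ha)) (hν0 a)
  have hνt : ∀ a ∉ t, ν a = 0 := fun a ha =>
    le_antisymm ((min_le_right _ _).trans_eq (hwt a ha)) (hν0 a)
  have hνsum : ∑ a ∈ s, ν a = ∑ a ∈ t, ν a :=
    Finset.sum_congr_of_eq_on_inter (fun a _ ha => hνt a ha) (fun a _ ha => hνs a ha)
      fun _ _ _ => rfl
  have hνsum' : ∑ a ∈ s, ν a • a = ∑ a ∈ t, ν a • a :=
    Finset.sum_congr_of_eq_on_inter (fun a _ ha => by rw [hνt a ha, zero_smul])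
      (fun a _ ha => by rw [hνs a ha, zero_smul]) fun _ _ _ => rfl
  let m : ℝ := 1 - ∑ a ∈ s, ν a
  -- the remaining weights, after division by `m`, describe a point of a face
  have hface : ∀ (s : Finset (Space d)) (w : Space d → ℝ) (x : Space d), s ∈ K.faces →
      (∀ a ∈ s, ν a ≤ w a) → ∑ a ∈ s, w a = 1 → ∑ a ∈ s, w a • a = x →
      m = 1 - ∑ a ∈ s, ν a → 0 < m →
      s.filter (fun a => ν a < w a) ∈ K.faces ∧
        ∃ x' ∈ simplex (s.filter (fun a => ν a < w a)), x = ∑ a ∈ s, ν a • a + m • x' := by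
    intro s w x hs hle h1 hx hm hm0
    have hsum : ∑ a ∈ s.filter (fun a => ν a < w a), (w a - ν a) = m := by
      rw [hm, ← h1, ← Finset.sum_sub_distrib]
      refine Finset.sum_filter_of_ne fun a ha h0 => ?_
      exact lt_of_le_of_ne (hle a ha) fun h => h0 (by rw [h, sub_self])
    refine ⟨K.toSimplicialComplex.down_closed hs (Finset.filter_subset _ _) ?_,
      ∑ a ∈ s.filter (fun a => ν a < w a), (m⁻¹ * (w a - ν a)) • a, ?_, ?_⟩
    · by_contra h
      rw [Finset.not_nonempty_iff_eq_empty] at h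
      rw [h, Finset.sum_empty] at hsum
      exact hm0.ne hsum
    · refine Finset.mem_convexHull'.2 ⟨fun a => m⁻¹ * (w a - ν a), fun a ha => ?_, ?_, rfl⟩
      · have := hle a (Finset.mem_filter.1 ha).1
        exact mul_nonneg (inv_nonneg.2 hm0.le) (by linarith)
      · rw [← Finset.mul_sum, hsum, inv_mul_cancel₀ hm0.ne']
    · have h2 : ∑ a ∈ s.filter (fun a => ν a < w a), (w a - ν a) • a =
          ∑ a ∈ s, (w a - ν a) • a := by
        refine Finset.sum_filter_of_ne fun a ha h0 => ?_
        exact lt_of_le_of_ne (hle a ha) fun h => h0 (by rw [h, sub_self, zero_smul])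
      rw [Finset.smul_sum]
      simp only [smul_smul, mul_inv_cancel_left₀ hm0.ne']
      rw [h2, ← hx, ← Finset.sum_add_distrib]
      exact Finset.sum_congr rfl fun a _ => by rw [← add_smul, add_sub_cancel]
  have hm0 : 0 < m := by
    have hm : 0 ≤ m := by
      have : ∑ a ∈ s, ν a ≤ ∑ a ∈ s, w a := Finset.sum_le_sum fun a _ => min_le_left _ _
      simp only [m]
      linarith
    refine lt_of_le_of_ne hm fun h0 => hne ?_
    have h1 : ∑ a ∈ s, ν a = ∑ a ∈ s, w a := by simp only [m] at h0; linarith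
    have h2 : ∑ a ∈ t, ν a = ∑ a ∈ t, w' a := by
      rw [← hνsum]; simp only [m] at h0; linarith
    have h3 := (Finset.sum_eq_sum_iff_of_le fun a _ => min_le_left (w a) (w' a)).1 h1
    have h4 := (Finset.sum_eq_sum_iff_of_le fun a _ => min_le_right (w a) (w' a)).1 h2
    rw [← hwx, ← hwy]
    have h5 : ∑ a ∈ s, w a • a = ∑ a ∈ s, ν a • a :=
      Finset.sum_congr rfl fun a ha => by rw [← h3 a ha]
    have h6 : ∑ a ∈ t, w' a • a = ∑ a ∈ t, ν a • a :=
      Finset.sum_congr rfl fun a ha => by rw [← h4 a ha]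
    rw [h5, h6, hνsum']
  obtain ⟨hs', x', hx', hxx'⟩ := hface s w x hs (fun a _ => min_le_left _ _) hw1 hwx rfl hm0
  obtain ⟨ht', y', hy', hyy'⟩ := hface t w' y ht (fun a _ => min_le_right _ _) hw'1 hwy
    (by simp only [m]; rw [hνsum]) hm0
  have hdisj : s.filter (fun a => ν a < w a) ∩ t.filter (fun a => ν a < w' a) = ∅ := by
    refine Finset.eq_empty_of_forall_notMem fun a ha => ?_
    obtain ⟨h1, h2⟩ := Finset.mem_inter.1 ha
    exact absurd (lt_min (Finset.mem_filter.1 h1).2 (Finset.mem_filter.1 h2).2) (lt_irrefl _)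
  have hmδ : m * δ ≤ ‖x - y‖ := by
    rw [hxx', hyy', hνsum', add_sub_add_left_eq_sub, ← smul_sub, norm_smul,
      Real.norm_of_nonneg hm0.le]
    exact mul_le_mul_of_nonneg_left (hdist _ hs' _ ht' hdisj x' hx' y' hy') hm0.le
  have hm1 : m < 1 := by
    by_contra! h
    nlinarith
  obtain ⟨c, hcs, hc⟩ : ∃ c ∈ s, 0 < ν c := by
    refine Finset.exists_lt_of_sum_lt ?_
    rw [Finset.sum_const_zero]
    simp only [m] at hm1
    linarith
  have hct : c ∈ t := by
    by_contra h
    exact hc.ne' (hνt c h)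
  -- the intermediate point keeps the common weights and moves the rest to a common vertex
  have hz : ∀ s : Finset (Space d), c ∈ s → m = 1 - ∑ a ∈ s, ν a →
      ∑ a ∈ s, ν a • a + m • c ∈ simplex s := by
    intro s hcs hm
    refine Finset.mem_convexHull'.2 ⟨fun a => ν a + if a = c then m else 0, fun a _ => ?_, ?_, ?_⟩
    · refine add_nonneg (hν0 a) ?_
      split_ifs
      exacts [hm0.le, le_rfl]
    · rw [Finset.sum_add_distrib, Finset.sum_ite_eq' s c, if_pos hcs, hm]
      ring
    · simp only [add_smul, ite_smul, zero_smul]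
      rw [Finset.sum_add_distrib, Finset.sum_ite_eq' s c, if_pos hcs]
  have hz1 := hz s hcs rfl
  have hz2 := hz t hct (by simp only [m]; rw [hνsum])
  rw [← hνsum'] at hz2
  refine ⟨∑ a ∈ s, ν a • a + m • c,
    ((convex_convexHull ℝ _).segment_subset hxs hz1).trans (simplex_subset_of_mem_faces hs),
    ((convex_convexHull ℝ _).segment_subset hz2 hyt).trans (simplex_subset_of_mem_faces ht), ?_⟩
  have hx'c : ‖x' - c‖ ≤ 2 * |D| := hD0 x' (simplex_subset_of_mem_faces hs' hx') c
    (simplex_subset_of_mem_faces hs (subset_convexHull ℝ _ hcs))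
  conv_lhs => rw [hxx', add_sub_add_left_eq_sub, ← smul_sub, norm_smul,
      Real.norm_of_nonneg hm0.le]
  rw [div_mul_eq_mul_div, le_div_iff₀ hδ]
  calc m * ‖x' - c‖ * δ = ‖x' - c‖ * (m * δ) := by ring
    _ ≤ 2 * |D| * ‖x - y‖ := by gcongr

/-- The sum of the piecewise linear hat functions of the vertices of `s`. -/
noncomputable def hatSum (K : Triangulation d Ω) (s : Finset (Space d)) (x : Space d) : ℝ := by
  classical
  exact if h : ∃ t ∈ K.elements, x ∈ simplex t then ∑ a ∈ s, bary h.choose a x else 0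

lemma hatSum_eq {t : Finset (Space d)} (ht : t ∈ K.elements) {x : Space d} (hx : x ∈ simplex t) :
    hatSum K s x = ∑ a ∈ s, bary t a x := by
  have h : ∃ t ∈ K.elements, x ∈ simplex t := ⟨t, ht, hx⟩
  rw [hatSum, dif_pos h]
  exact Finset.sum_congr rfl fun a _ =>
    (bary_of_mem_of_mem h.choose_spec.1 ht h.choose_spec.2 hx a).1

lemma abs_hatSum_sub_le {ρ h : ℝ} (hρ : 0 < ρ) (hK : K.IsQuasiUniform ρ h)
    (hs : s ∈ K.elements) {x y : Space d} (hxy : segment ℝ x y ⊆ Ω) :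
    |hatSum K s x - hatSum K s y| ≤ (d + 1) / (ρ * h) * ‖x - y‖ := by
  obtain ⟨hh, hK⟩ := hK
  refine abs_sub_le_of_segment_subset (fun t _ => (isCompact_simplex t).isClosed)
    (fun t ht u hu v hv => ?_) (hxy.trans_eq (domain_eq_biUnion K))
  obtain ⟨-, x₀, hx₀⟩ := hK t ht
  rw [hatSum_eq ht hu, hatSum_eq ht hv, ← Finset.sum_sub_distrib]
  calc |∑ a ∈ s, (bary t a u - bary t a v)| ≤ ∑ a ∈ s, |bary t a u - bary t a v| :=
        Finset.abs_sum_le_sum_abs _ _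
    _ ≤ ∑ a ∈ s, 1 / (ρ * h) * ‖u - v‖ := Finset.sum_le_sum fun a _ =>
        (isFullSimplex_of_mem ht).abs_bary_sub_le (by positivity) hx₀ a u v
    _ = (d + 1) / (ρ * h) * ‖u - v‖ := by
        rw [Finset.sum_const, (mem_elements.1 hs).2, nsmul_eq_mul]
        push_cast
        ring

lemma mem_enlarge_of_hatSum_pos {t : Finset (Space d)} (ht : t ∈ K.elements) {x : Space d}
    (hx : x ∈ simplex t) (hpos : 0 < hatSum K s x) : t ∈ enlarge K {s} := by
  rw [hatSum_eq ht hx] at hpos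
  obtain ⟨a, ha, h0⟩ := Finset.exists_ne_zero_of_sum_ne_zero hpos.ne'
  exact mem_enlarge_singleton.2 ⟨ht, a, ha, by_contra fun h => h0 (bary_of_notMem h x)⟩

/-- Points at a distance much smaller than the mesh size from an element `s` are reached from `s`
through elements that share a vertex with `s`. Hence a function that is Lipschitz on each of these
elements satisfies a Lipschitz estimate from `s` to nearby points of the domain. -/
lemma Triangulation.exists_patch_lipschitz (K₀ : Triangulation d Ω) {ρ : ℝ} (hρ : 0 < ρ) :
    ∃ L δ : ℝ, 1 ≤ L ∧ 0 < δ ∧ ∀ (K : Triangulation d Ω) (h : ℝ), K.IsQuasiUniform ρ h →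
      ∀ s ∈ K.elements, ∀ x ∈ simplex s, ∀ y ∈ Ω, ‖x - y‖ < δ → ‖x - y‖ < δ * h →
      ∀ (f : Space d → ℝ) (c : ℝ),
        (∀ t ∈ enlarge K {s}, ∀ u ∈ simplex t, ∀ v ∈ simplex t, |f u - f v| ≤ c * ‖u - v‖) →
        0 ≤ c → |f x - f y| ≤ L * c * ‖x - y‖ := by
  classical
  obtain ⟨L, δ, hL, hδ, hqc⟩ := K₀.exists_quasiconvex
  have hd : (0 : ℝ) < (d + 1) * (2 * L + 1) := by positivity
  refine ⟨2 * L + 1, min δ (ρ / ((d + 1) * (2 * L + 1))), by linarith, by positivity,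
    fun K h hK s hs x hx y hy h1 h2 f c hf hc => ?_⟩
  have hh : 0 < h := hK.1
  obtain ⟨z, hxz, hzy, hxz'⟩ := hqc x (simplex_subset hs hx) y hy
    (h1.trans_le (min_le_left _ _))
  have hzy' : ‖z - y‖ ≤ (L + 1) * ‖x - y‖ := by
    have h3 : ‖z - y‖ ≤ ‖x - z‖ + ‖x - y‖ := by
      rw [norm_sub_rev x z]
      simpa using norm_add_le (z - x) (x - y)
    linarith
  have hsmall : (d + 1) / (ρ * h) * ((2 * L + 1) * ‖x - y‖) < 1 := by
    have h3 : ‖x - y‖ < ρ / ((d + 1) * (2 * L + 1)) * h :=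
      h2.trans_le (mul_le_mul_of_nonneg_right (min_le_right _ _) hh.le)
    rw [div_mul_eq_mul_div, lt_div_iff₀ hd] at h3
    rw [div_mul_eq_mul_div, div_lt_one (by positivity)]
    linarith
  have hx1 : hatSum K s x = 1 := by
    rw [hatSum_eq hs hx, (isFullSimplex_of_mem hs).sum_bary]
  have hcoef : (0 : ℝ) ≤ (d + 1) / (ρ * h) := by positivity
  have hsub : ∀ u v w : Space d, w ∈ segment ℝ u v → segment ℝ u w ⊆ segment ℝ u v :=
    fun u v w hw => (convex_segment u v).segment_subset (left_mem_segment ℝ u v) hw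
  have hlen : ∀ u v w : Space d, w ∈ segment ℝ u v → ‖u - w‖ ≤ ‖u - v‖ := by
    intro u v w hw
    have := dist_add_dist_of_mem_segment hw
    rw [← dist_eq_norm, ← dist_eq_norm]
    linarith [dist_nonneg (x := w) (y := v)]
  have hpos1 : ∀ u ∈ segment ℝ x z, 1 - (d + 1) / (ρ * h) * (L * ‖x - y‖) ≤ hatSum K s u := by
    intro u hu
    have h3 := abs_hatSum_sub_le hρ hK hs ((hsub _ _ _ hu).trans hxz)
    have h4 := mul_le_mul_of_nonneg_left ((hlen _ _ _ hu).trans hxz') hcoef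
    have h5 := le_abs_self (hatSum K s x - hatSum K s u)
    linarith
  have hpos2 : ∀ u ∈ segment ℝ z y, 0 < hatSum K s u := by
    intro u hu
    have h3 := abs_hatSum_sub_le hρ hK hs ((hsub _ _ _ hu).trans hzy)
    have h4 := mul_le_mul_of_nonneg_left ((hlen _ _ _ hu).trans hzy') hcoef
    have h5 := le_abs_self (hatSum K s z - hatSum K s u)
    have h6 := hpos1 z (right_mem_segment ℝ x z)
    linarith
  have hpos1' : ∀ u ∈ segment ℝ x z, 0 < hatSum K s u := by
    intro u hu
    have h3 := hpos1 u hu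
    have h4 := mul_nonneg hcoef (mul_nonneg (add_nonneg hL zero_le_one) (norm_nonneg (x - y)))
    linarith
  have hcov : ∀ u v : Space d, segment ℝ u v ⊆ Ω → (∀ w ∈ segment ℝ u v, 0 < hatSum K s w) →
      segment ℝ u v ⊆ ⋃ t ∈ K.elements.filter (fun t => t ∈ enlarge K {s}), simplex t := by
    intro u v huv hpos w hw
    obtain ⟨t, ht, hwt⟩ := exists_element_of_mem K (huv hw)
    exact mem_biUnion (Finset.mem_filter.2 ⟨ht, mem_enlarge_of_hatSum_pos ht hwt (hpos w hw)⟩) hwt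
  have hlip : ∀ u v : Space d, segment ℝ u v ⊆ Ω → (∀ w ∈ segment ℝ u v, 0 < hatSum K s w) →
      |f u - f v| ≤ c * ‖u - v‖ := fun u v huv hpos =>
    abs_sub_le_of_segment_subset (fun t _ => (isCompact_simplex t).isClosed)
      (fun t ht => hf t (Finset.mem_filter.1 ht).2) (hcov u v huv hpos)
  calc |f x - f y| ≤ |f x - f z| + |f z - f y| := abs_sub_le _ _ _
    _ ≤ c * ‖x - z‖ + c * ‖z - y‖ := add_le_add (hlip x z hxz hpos1') (hlip z y hzy hpos2)
    _ ≤ c * (L * ‖x - y‖) + c * ((L + 1) * ‖x - y‖) := by gcongr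
    _ = (2 * L + 1) * c * ‖x - y‖ := by ring

end Paths

/-! ### Maps close to the identity -/

section NearIdentity

variable {d : ℕ}

/-- A continuously differentiable map whose derivative differs from the identity by at most `1/2`
in operator norm on `B`. -/
structure IsNearId (Ψ : Space d → Space d) (B : Set (Space d)) : Prop where
  contDiff : ContDiff ℝ 1 Ψ
  norm_fderiv_sub_le : ∀ x ∈ B, ‖fderiv ℝ Ψ x - ContinuousLinearMap.id ℝ (Space d)‖ ≤ 1 / 2

namespace IsNearId

variable {Ψ : Space d → Space d} {x₀ : Space d} {R : ℝ}

lemma differentiable (hΨ : IsNearId Ψ (closedBall x₀ R)) : Differentiable ℝ Ψ :=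
  hΨ.contDiff.differentiable one_ne_zero

lemma norm_sub_sub_le (hΨ : IsNearId Ψ (closedBall x₀ R)) {x y : Space d}
    (hx : x ∈ closedBall x₀ R) (hy : y ∈ closedBall x₀ R) :
    ‖Ψ x - Ψ y - (x - y)‖ ≤ 1 / 2 * ‖x - y‖ := by
  have h1 := (convex_closedBall x₀ R).norm_image_sub_le_of_norm_fderiv_le'
    (𝕜 := ℝ) (f := Ψ) (φ := ContinuousLinearMap.id ℝ (Space d)) (C := 1 / 2)
    (fun z _ => hΨ.differentiable z) hΨ.norm_fderiv_sub_le hy hx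
  exact h1

lemma norm_sub_le (hΨ : IsNearId Ψ (closedBall x₀ R)) {x y : Space d}
    (hx : x ∈ closedBall x₀ R) (hy : y ∈ closedBall x₀ R) :
    ‖x - y‖ ≤ 2 * ‖Ψ x - Ψ y‖ := by
  have h1 := hΨ.norm_sub_sub_le hx hy
  have h2 := norm_sub_norm_le (x - y) (Ψ x - Ψ y)
  rw [norm_sub_rev (x - y)] at h2
  linarith

lemma injOn (hΨ : IsNearId Ψ (closedBall x₀ R)) : InjOn Ψ (closedBall x₀ R) :=
  fun x hx y hy hxy => by
    have := hΨ.norm_sub_le hx hy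
    rw [hxy, sub_self, norm_zero, mul_zero] at this
    exact sub_eq_zero.1 (norm_le_zero_iff.1 this)

/-- The image of a ball contains the ball of half the radius around the image of the center. -/
lemma closedBall_subset_image (hΨ : IsNearId Ψ (closedBall x₀ R)) {y : Space d} {r : ℝ}
    (hr : 0 ≤ r) (hsub : closedBall y r ⊆ closedBall x₀ R) :
    closedBall (Ψ y) (r / 2) ⊆ Ψ '' closedBall y r := by
  have happ : ApproximatesLinearOn Ψ
      ((ContinuousLinearEquiv.refl ℝ (Space d)) : Space d →L[ℝ] Space d) (closedBall y r)
      (1 / 2) := fun u hu v hv => by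
    simpa using hΨ.norm_sub_sub_le (hsub hu) (hsub hv)
  let inv : ContinuousLinearMap.NonlinearRightInverse
      ((ContinuousLinearEquiv.refl ℝ (Space d)) : Space d →L[ℝ] Space d) :=
    { toFun := id
      nnnorm := 1
      bound' := fun y => by simp
      right_inv' := fun y => rfl }
  have := happ.surjOn_closedBall_of_nonlinearRightInverse inv hr subset_rfl
  intro z hz
  refine this ?_
  have hc : ((inv.nnnorm : ℝ)⁻¹ - ((1 / 2 : NNReal) : ℝ)) * r = r / 2 := by
    simp only [inv]
    push_cast
    ring
  rwa [hc]

lemma fderiv_apply_le (hΨ : IsNearId Ψ (closedBall x₀ R)) {y : Space d}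
    (hy : y ∈ closedBall x₀ R) : ‖fderiv ℝ Ψ y‖ ≤ 2 := by
  have h1 := hΨ.norm_fderiv_sub_le y hy
  have h2 := norm_add_le (fderiv ℝ Ψ y - ContinuousLinearMap.id ℝ (Space d))
    (ContinuousLinearMap.id ℝ (Space d))
  rw [sub_add_cancel] at h2
  have h3 : ‖ContinuousLinearMap.id ℝ (Space d)‖ ≤ 1 := ContinuousLinearMap.norm_id_le
  linarith

/-- The derivative of a map close to the identity is invertible, with inverse of norm at
most `2`. -/
lemma exists_fderiv_eq_equiv (hΨ : IsNearId Ψ (closedBall x₀ R)) {y : Space d}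
    (hy : y ∈ closedBall x₀ R) : ∃ e : Space d ≃L[ℝ] Space d,
      (e : Space d →L[ℝ] Space d) = fderiv ℝ Ψ y ∧ ∀ u, ‖e.symm u‖ ≤ 2 * ‖u‖ := by
  have hlow : ∀ u, ‖u‖ ≤ 2 * ‖fderiv ℝ Ψ y u‖ := fun u => by
    have h1 := (fderiv ℝ Ψ y - ContinuousLinearMap.id ℝ (Space d)).le_of_opNorm_le
      (hΨ.norm_fderiv_sub_le y hy) u
    have h2 := norm_sub_norm_le u (fderiv ℝ Ψ y u)
    rw [norm_sub_rev] at h2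
    simp only [_root_.sub_apply, ContinuousLinearMap.id_apply] at h1
    linarith
  have hinj : Function.Injective (fderiv ℝ Ψ y : Space d →ₗ[ℝ] Space d) := by
    rw [injective_iff_map_eq_zero]
    intro u hu
    have := hlow u
    rw [show fderiv ℝ Ψ y u = 0 from hu, norm_zero, mul_zero] at this
    exact norm_le_zero_iff.1 this
  let e := (LinearEquiv.ofInjectiveEndo _ hinj).toContinuousLinearEquiv
  have he : (e : Space d →L[ℝ] Space d) = fderiv ℝ Ψ y := by
    ext1 u
    rfl
  refine ⟨e, he, fun u => ?_⟩
  have h1 := hlow (e.symm u)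
  rw [← he] at h1
  simpa using h1

/-- Transformation of gradients: if `v ∘ Ψ` agrees near `y` with a differentiable function `w`,
then the gradients of `v` at `Ψ y` and of `w` at `y` are comparable. -/
lemma gradient_comparison (hΨ : IsNearId Ψ (closedBall x₀ R)) {U : Set (Space d)}
    (hU : IsOpen U) (hUB : U ⊆ closedBall x₀ R) {v w : Space d → ℝ} (hw : Differentiable ℝ w)
    (hvw : EqOn (v ∘ Ψ) w U) {y : Space d} (hy : y ∈ U) :
    ‖fderiv ℝ w y‖ ≤ 2 * ‖gradient v (Ψ y)‖ ∧ ‖gradient v (Ψ y)‖ ≤ 2 * ‖fderiv ℝ w y‖ := by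
  obtain ⟨e, he, hes⟩ := hΨ.exists_fderiv_eq_equiv (hUB hy)
  have hstrict : HasStrictFDerivAt Ψ (e : Space d →L[ℝ] Space d) y := by
    rw [he]
    exact hΨ.contDiff.contDiffAt.hasStrictFDerivAt one_ne_zero
  have hg := hstrict.to_localInverse
  have hev : v =ᶠ[nhds (Ψ y)] w ∘ hstrict.localInverse Ψ e y := by
    filter_upwards [hstrict.eventually_right_inverse,
      hstrict.localInverse_tendsto.eventually (hU.mem_nhds hy)] with z hz hzU
    rw [Function.comp_apply, ← hvw hzU, Function.comp_apply, hz]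
  have hv : HasFDerivAt v ((fderiv ℝ w y).comp (e.symm : Space d →L[ℝ] Space d)) (Ψ y) := by
    have h1 : HasFDerivAt w (fderiv ℝ w y) (hstrict.localInverse Ψ e y (Ψ y)) := by
      rw [hstrict.localInverse_apply_image]
      exact (hw y).hasFDerivAt
    exact (h1.comp _ hg.hasFDerivAt).congr_of_eventuallyEq hev
  have hgrad : ‖gradient v (Ψ y)‖ =
      ‖(fderiv ℝ w y).comp (e.symm : Space d →L[ℝ] Space d)‖ := by
    rw [gradient, LinearIsometryEquiv.norm_map, hv.fderiv]
  rw [hgrad]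
  constructor
  · have h1 : fderiv ℝ w y =
        ((fderiv ℝ w y).comp (e.symm : Space d →L[ℝ] Space d)).comp (fderiv ℝ Ψ y) := by
      rw [← he]
      ext1 u
      simp
    calc ‖fderiv ℝ w y‖
        ≤ ‖(fderiv ℝ w y).comp (e.symm : Space d →L[ℝ] Space d)‖ * ‖fderiv ℝ Ψ y‖ := by
          conv_lhs => rw [h1]
          exact ContinuousLinearMap.opNorm_comp_le _ _
      _ ≤ ‖(fderiv ℝ w y).comp (e.symm : Space d →L[ℝ] Space d)‖ * 2 := by
          gcongr
          exact hΨ.fderiv_apply_le (hUB hy)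
      _ = _ := mul_comm _ _
  · have h2 : ‖(e.symm : Space d →L[ℝ] Space d)‖ ≤ 2 :=
      ContinuousLinearMap.opNorm_le_bound _ zero_le_two hes
    calc _ ≤ ‖fderiv ℝ w y‖ * ‖(e.symm : Space d →L[ℝ] Space d)‖ :=
          ContinuousLinearMap.opNorm_comp_le _ _
      _ ≤ ‖fderiv ℝ w y‖ * 2 := by gcongr
      _ = _ := mul_comm _ _

end IsNearId

end NearIdentity

/-! ### Extended deformations -/

section Deformations

variable {d : ℕ} {Ω : Set (Space d)} {K : Triangulation d Ω} {s : Finset (Space d)}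

lemma polyExt_spec {k : ℕ} {g : Space d → ℝ}
    (hg : ∃ p ∈ polySpace d k, EqOn g p (simplex s)) :
    polyExt k s g ∈ polySpace d k ∧ EqOn (polyExt k s g) g (simplex s) := by
  have h : ∃ f ∈ polySpace d k, EqOn f g (simplex s) := hg.imp fun p hp => ⟨hp.1, hp.2.symm⟩
  rw [polyExt, dif_pos h]
  exact h.choose_spec

lemma IsMeshDeformation.polyExt_spec {q : ℕ} {C h : ℝ} {Θ : Space d → Space d}
    (hΘ : IsMeshDeformation K q C h Θ) (hs : s ∈ K.elements) (j : Fin d) :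
    polyExt q s (fun y => Θ y j) ∈ polySpace d q ∧
      EqOn (polyExt q s (fun y => Θ y j)) (fun y => Θ y j) (simplex s) :=
  MeshTransfer.polyExt_spec ((hΘ.mem_feSpace j).2 s hs)

lemma IsMeshDeformation.deformExt_eqOn {q : ℕ} {C h : ℝ} {Θ : Space d → Space d}
    (hΘ : IsMeshDeformation K q C h Θ) (hs : s ∈ K.elements) :
    EqOn (deformExt q s Θ) Θ (simplex s) := fun x hx => by
  ext j
  exact (hΘ.polyExt_spec hs j).2 hx

lemma norm_le_sum_abs (x : Space d) : ‖x‖ ≤ ∑ j, |x j| := by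
  have h2 : x = ∑ i, x i • EuclideanSpace.single i (1 : ℝ) := by
    conv_lhs => rw [← (EuclideanSpace.basisFun (Fin d) ℝ).sum_repr x]
    simp
  calc ‖x‖ = ‖∑ i, x i • EuclideanSpace.single i (1 : ℝ)‖ := by rw [← h2]
    _ ≤ ∑ i, ‖x i • EuclideanSpace.single i (1 : ℝ)‖ := norm_sum_le _ _
    _ = ∑ j, |x j| := by simp [norm_smul]

lemma abs_apply_le_norm (x : Space d) (j : Fin d) : |x j| ≤ ‖x‖ := by
  rw [← Real.norm_eq_abs]
  exact PiLp.norm_apply_le x j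

/-- An inverse estimate turns the bound `C h²` on a deformation minus the identity into a bound of
order `h` on its derivative, also beyond the element. -/
lemma exists_isNearId_deformExt (d : ℕ) {q : ℕ} (hq : 1 ≤ q) {ρ : ℝ} (hρ : 0 < ρ) :
    ∃ A : ℝ, 0 < A ∧ ∀ {Ω : Set (Space d)} (K : Triangulation d Ω) (C h : ℝ)
      (Θ : Space d → Space d), 0 < h → 0 ≤ C → A * C * h ≤ 1 / 2 → IsMeshDeformation K q C h Θ →
      ∀ s ∈ K.elements, ∀ x₀, closedBall x₀ (ρ * h) ⊆ simplex s →
        IsNearId (deformExt q s Θ) (closedBall x₀ (3 * h)) := by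
  obtain ⟨A, hA, H⟩ := exists_ball_bound d q hρ
  refine ⟨(d + 1) * A, by positivity, fun K C h Θ hh hC hsmall hΘ s hs x₀ hx₀ => ?_⟩
  have hdiff : ∀ j, ContDiff ℝ 1 (polyExt q s (fun y => Θ y j)) := fun j =>
    contDiff_one_iff_fderiv.2 ⟨differentiable_of_mem_polySpace (hΘ.polyExt_spec hs j).1,
      continuous_fderiv_of_mem_polySpace (hΘ.polyExt_spec hs j).1⟩
  have hcd : ContDiff ℝ 1 (deformExt q s Θ) :=
    contDiff_euclidean.2 fun j => hdiff j
  refine ⟨hcd, fun x hx => ?_⟩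
  refine ContinuousLinearMap.opNorm_le_bound _ (by norm_num) fun e => ?_
  have hcomp : ∀ j, |(fderiv ℝ (deformExt q s Θ) x e - e) j| ≤ A * C * h * ‖e‖ := by
    intro j
    have hmem : (fun y : Space d => polyExt q s (fun y => Θ y j) y + (-1) * y j) ∈
        polySpace d q :=
      add_mem_polySpace (hΘ.polyExt_spec hs j).1
        (const_mul_mem_polySpace _ (polySpace_mono hq (coord_mem_polySpace j)))
    have hbound := (H _ hmem x₀ h (C * h ^ 2) hh (fun y hy => ?_) x hx).2
    · have h1 : HasFDerivAt (fun y : Space d => polyExt q s (fun y => Θ y j) y + (-1) * y j)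
          ((EuclideanSpace.proj j : Space d →L[ℝ] ℝ).comp (fderiv ℝ (deformExt q s Θ) x) +
            (-1 : ℝ) • (EuclideanSpace.proj j : Space d →L[ℝ] ℝ)) x := by
        have h2 : HasFDerivAt (deformExt q s Θ) (fderiv ℝ (deformExt q s Θ) x) x :=
          (hcd.differentiable one_ne_zero x).hasFDerivAt
        have h3 : HasFDerivAt (fun y : Space d => polyExt q s (fun y => Θ y j) y)
            ((EuclideanSpace.proj j : Space d →L[ℝ] ℝ).comp (fderiv ℝ (deformExt q s Θ) x)) x :=
          (EuclideanSpace.proj j : Space d →L[ℝ] ℝ).hasFDerivAt.comp x h2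
        have h4 : HasFDerivAt (fun y : Space d => y j)
            (EuclideanSpace.proj j : Space d →L[ℝ] ℝ) x :=
          (EuclideanSpace.proj j : Space d →L[ℝ] ℝ).hasFDerivAt
        exact h3.add (h4.const_mul (-1))
      rw [h1.fderiv] at hbound
      have h5 := ContinuousLinearMap.le_of_opNorm_le _ hbound e
      have h6 : A * (C * h ^ 2) / h = A * C * h := by field_simp
      rw [h6] at h5
      simpa [sub_eq_add_neg] using h5
    · have h1 := hΘ.small y (simplex_subset hs (hx₀ hy))
      have h2 := abs_apply_le_norm (Θ y - y) j
      rw [(hΘ.polyExt_spec hs j).2 (hx₀ hy)]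
      simp only [PiLp.sub_apply] at h2
      rw [neg_one_mul, ← sub_eq_add_neg]
      exact h2.trans h1
  calc ‖(fderiv ℝ (deformExt q s Θ) x - ContinuousLinearMap.id ℝ (Space d)) e‖
      ≤ ∑ j, |(fderiv ℝ (deformExt q s Θ) x e - e) j| := norm_le_sum_abs _
    _ ≤ ∑ _j : Fin d, A * C * h * ‖e‖ := Finset.sum_le_sum fun j _ => hcomp j
    _ = d * (A * C * h * ‖e‖) := by simp
    _ ≤ (d + 1) * (A * C * h * ‖e‖) := by
        have : 0 ≤ A * C * h * ‖e‖ := by positivity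
        linarith
    _ = (d + 1) * A * C * h * ‖e‖ := by ring
    _ ≤ 1 / 2 * ‖e‖ := by gcongr

lemma IsMeshDeformation.mono {q : ℕ} {C C' h : ℝ} {Θ : Space d → Space d}
    (hΘ : IsMeshDeformation K q C h Θ) (hC : C ≤ C') : IsMeshDeformation K q C' h Θ :=
  ⟨hΘ.bijOn, hΘ.mem_feSpace, fun x hx => (hΘ.small x hx).trans (by gcongr)⟩

lemma IsMeshDeformation.continuousOn {q : ℕ} {C h : ℝ} {Θ : Space d → Space d}
    (hΘ : IsMeshDeformation K q C h Θ) : ContinuousOn Θ Ω :=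
  (PiLp.continuous_toLp 2 _).comp_continuousOn
    (continuousOn_pi.2 fun j => (hΘ.mem_feSpace j).1)

lemma deformInv_apply {Θ : Space d → Space d} (hΘ : InjOn Θ Ω) {x : Space d} (hx : x ∈ Ω) :
    deformInv Ω Θ (Θ x) = x :=
  hΘ.leftInvOn_invFunOn hx

/-- The pullback of a function of the mapped finite element space is polynomial on each
element. -/
lemma exists_poly_comp_of_mem_mappedFESpace {k : ℕ} {Θ : Space d → Space d} (hΘ : BijOn Θ Ω Ω)
    {v : Space d → ℝ} (hv : v ∈ mappedFESpace K k Θ) (hs : s ∈ K.elements) :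
    ∃ p ∈ polySpace d k, EqOn (v ∘ Θ) p (simplex s) := by
  obtain ⟨w, hw, hvw⟩ := hv
  obtain ⟨p, hp, hwp⟩ := hw.2 s hs
  refine ⟨p, hp, fun x hx => ?_⟩
  rw [Function.comp_apply, hvw _ (hΘ.mapsTo (simplex_subset hs hx)),
    deformInv_apply hΘ.injOn (simplex_subset hs hx), hwp hx]

end Deformations

/-! ### Square integrals over deformed elements -/

section SquareIntegrals

variable {d : ℕ} {s : Finset (Space d)}

lemma eLpNorm_two_sq {E : Type*} [NormedAddCommGroup E] (f : Space d → E)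
    (μ : Measure (Space d)) : eLpNorm f 2 μ ^ 2 = ∫⁻ x, ‖f x‖ₑ ^ 2 ∂μ := by
  rw [eLpNorm_eq_lintegral_rpow_enorm_toReal two_ne_zero ENNReal.ofNat_ne_top, ← ENNReal.rpow_two]
  simp only [ENNReal.toReal_ofNat, one_div]
  rw [← ENNReal.rpow_mul, inv_mul_cancel₀ (two_ne_zero : (2 : ℝ) ≠ 0), ENNReal.rpow_one]
  simp_rw [ENNReal.rpow_two]

lemma ofReal_mul_eLpNorm_le {E F : Type*} [NormedAddCommGroup E] [NormedAddCommGroup F]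
    {f : Space d → E} {g : Space d → F} {μ ν : Measure (Space d)} {a b : ℝ} (ha : 0 ≤ a)
    (hb : 0 ≤ b) (h : ENNReal.ofReal (a ^ 2) * ∫⁻ x, ‖f x‖ₑ ^ 2 ∂μ ≤
      ENNReal.ofReal (b ^ 2) * ∫⁻ x, ‖g x‖ₑ ^ 2 ∂ν) :
    ENNReal.ofReal a * eLpNorm f 2 μ ≤ ENNReal.ofReal b * eLpNorm g 2 ν := by
  rw [← eLpNorm_two_sq, ← eLpNorm_two_sq, ENNReal.ofReal_pow ha, ENNReal.ofReal_pow hb,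
    ← mul_pow, ← mul_pow] at h
  exact (ENNReal.pow_le_pow_left_iff two_ne_zero).1 h

/-- A lower bound on a small ball inside an element bounds the square integral over the image of
the element from below. -/
lemma le_setLIntegral_image {E : Type*} [NormedAddCommGroup E] {Ψ : Space d → Space d}
    {x₀ y₀ : Space d} {h R δ M : ℝ} (hh : 0 < h) (hδ : 0 < δ) (hM : 0 ≤ M)
    (hΨ : IsNearId Ψ (closedBall x₀ R)) (hs : simplex s ⊆ closedBall x₀ R)
    (hy : ball y₀ (δ * h) ⊆ simplex s) {g : Space d → E}
    (hg : ∀ x ∈ ball y₀ (δ * h), M ≤ ‖g (Ψ x)‖) :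
    ENNReal.ofReal ((δ / 4) ^ d * h ^ d * M ^ 2) * volume (ball (0 : Space d) 1) ≤
      ∫⁻ x in Ψ '' simplex s, ‖g x‖ₑ ^ 2 := by
  have hsub : closedBall y₀ (δ * h / 2) ⊆ ball y₀ (δ * h) :=
    closedBall_subset_ball (half_lt_self (by positivity))
  have himg := hΨ.closedBall_subset_image (y := y₀) (r := δ * h / 2) (by positivity)
    (hsub.trans (hy.trans hs))
  have hr : δ * h / 2 / 2 = δ / 4 * h := by ring
  rw [hr] at himg
  calc ENNReal.ofReal ((δ / 4) ^ d * h ^ d * M ^ 2) * volume (ball (0 : Space d) 1)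
      = ENNReal.ofReal (M ^ 2) * volume (closedBall (Ψ y₀) (δ / 4 * h)) := by
        rw [Measure.addHaar_closedBall _ _ (by positivity), ← mul_assoc,
          ← ENNReal.ofReal_mul (by positivity), finrank_euclideanSpace_fin, mul_pow]
        congr 2
        ring
    _ = ∫⁻ _x in closedBall (Ψ y₀) (δ / 4 * h), ENNReal.ofReal (M ^ 2) :=
        (setLIntegral_const _ _).symm
    _ ≤ ∫⁻ x in closedBall (Ψ y₀) (δ / 4 * h), ‖g x‖ₑ ^ 2 := by
        refine setLIntegral_mono' measurableSet_closedBall fun x hx => ?_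
        obtain ⟨y, hy', rfl⟩ := himg hx
        rw [← ofReal_norm, ← ENNReal.ofReal_pow (norm_nonneg _)]
        exact ENNReal.ofReal_le_ofReal (pow_le_pow_left₀ hM (hg y (hsub hy')) 2)
    _ ≤ ∫⁻ x in Ψ '' simplex s, ‖g x‖ₑ ^ 2 :=
        lintegral_mono_set (himg.trans (image_mono (hsub.trans hy)))

lemma setLIntegral_sq_le {E : Type*} [NormedAddCommGroup E] {T U N : Set (Space d)}
    {z : Space d} {r B : ℝ} (hr : 0 ≤ r) (hTU : T ⊆ U ∪ N) (hU : U ⊆ closedBall z r)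
    (hN : volume N = 0) {g : Space d → E} (hg : ∀ x ∈ U, ‖g x‖ ≤ B) :
    ∫⁻ x in T, ‖g x‖ₑ ^ 2 ≤
      ENNReal.ofReal (r ^ d * B ^ 2) * volume (ball (0 : Space d) 1) := by
  calc ∫⁻ x in T, ‖g x‖ₑ ^ 2 ≤ ∫⁻ x in U ∪ N, ‖g x‖ₑ ^ 2 := lintegral_mono_set hTU
    _ ≤ (∫⁻ x in U, ‖g x‖ₑ ^ 2) + ∫⁻ x in N, ‖g x‖ₑ ^ 2 := lintegral_union_le _ _ _
    _ = ∫⁻ x in U, ‖g x‖ₑ ^ 2 := by rw [setLIntegral_measure_zero _ _ hN, add_zero]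
    _ ≤ ∫⁻ _x in U, ENNReal.ofReal (B ^ 2) := by
        refine setLIntegral_mono measurable_const fun x hx => ?_
        rw [← ofReal_norm, ← ENNReal.ofReal_pow (norm_nonneg _)]
        exact ENNReal.ofReal_le_ofReal (pow_le_pow_left₀ (norm_nonneg _) (hg x hx) 2)
    _ = ENNReal.ofReal (B ^ 2) * volume U := setLIntegral_const _ _
    _ ≤ ENNReal.ofReal (B ^ 2) * volume (closedBall z r) := by gcongr
    _ = ENNReal.ofReal (r ^ d * B ^ 2) * volume (ball (0 : Space d) 1) := by
        rw [Measure.addHaar_closedBall _ _ hr, ← mul_assoc,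
          ← ENNReal.ofReal_mul (by positivity), finrank_euclideanSpace_fin, mul_comm (B ^ 2)]

lemma volume_image_frontier_eq_zero {Ψ : Space d → Space d} (hΨ : Differentiable ℝ Ψ)
    (s : Finset (Space d)) : volume (Ψ '' frontier (simplex s)) = 0 :=
  addHaar_image_eq_zero_of_differentiableOn_of_addHaar_eq_zero volume hΨ.differentiableOn
    ((convex_convexHull ℝ _).addHaar_frontier volume)

lemma image_simplex_subset (Ψ : Space d → Space d) (s : Finset (Space d)) :
    Ψ '' simplex s ⊆ Ψ '' interior (simplex s) ∪ Ψ '' frontier (simplex s) := by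
  rw [← image_union, ← closure_eq_interior_union_frontier]
  exact image_mono subset_closure

lemma IsNearId.image_subset_closedBall {Ψ : Space d → Space d} {x₀ : Space d} {h : ℝ}
    (hh : 0 < h) (hΨ : IsNearId Ψ (closedBall x₀ (3 * h))) :
    Ψ '' closedBall x₀ h ⊆ closedBall (Ψ x₀) (2 * h) := by
  rintro _ ⟨x, hx, rfl⟩
  have h1 := hΨ.norm_sub_sub_le (closedBall_subset_closedBall (by linarith) hx)
    (mem_closedBall_self (by positivity))
  have h2 := norm_sub_norm_le (Ψ x - Ψ x₀) (x - x₀)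
  rw [mem_closedBall, dist_eq_norm] at hx ⊢
  linarith

/-- Inverse estimate on a deformed element. -/
lemma exists_inverse_estimate (d k : ℕ) {ρ : ℝ} (hρ : 0 < ρ) (hρ1 : ρ ≤ 1) :
    ∃ c : ℝ, 0 < c ∧ ∀ (s : Finset (Space d)) (x₀ : Space d) (h : ℝ) (Ψ : Space d → Space d)
      (v W : Space d → ℝ), 0 < h → closedBall x₀ (ρ * h) ⊆ simplex s →
      simplex s ⊆ closedBall x₀ h → IsNearId Ψ (closedBall x₀ (3 * h)) → W ∈ polySpace d k →
      EqOn (v ∘ Ψ) W (simplex s) →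
      ENNReal.ofReal (h ^ 2) * ∫⁻ x in Ψ '' simplex s, ‖gradient v x‖ₑ ^ 2 ≤
        ENNReal.ofReal c * ∫⁻ x in Ψ '' simplex s, ‖v x‖ₑ ^ 2 := by
  obtain ⟨A, δ, hA, hδ, H⟩ := exists_ball_lower_bound d k hρ hρ1
  have hA0 : 0 < A := by linarith
  refine ⟨2 ^ d * (4 * A ^ 2) / (δ / 4) ^ d, by positivity,
    fun s x₀ h Ψ v W hh hball hsub hΨ hW hvW => ?_⟩
  obtain ⟨M, hM, ⟨y₀, hy₀, hlow⟩, hup⟩ := H W hW x₀ h hh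
  have hsub3 : simplex s ⊆ closedBall x₀ (3 * h) :=
    hsub.trans (closedBall_subset_closedBall (by linarith))
  have hy₀s : ball y₀ (δ * h) ⊆ simplex s := (hy₀.trans ball_subset_closedBall).trans hball
  have h1 := le_setLIntegral_image hh hδ hM hΨ hsub3 hy₀s (g := v) fun x hx => by
    rw [← Function.comp_apply (f := v), hvW (hy₀s hx)]
    exact hlow x hx
  have h2 : ∫⁻ x in Ψ '' simplex s, ‖gradient v x‖ₑ ^ 2 ≤
      ENNReal.ofReal ((2 * h) ^ d * (2 * (A * M / h)) ^ 2) * volume (ball (0 : Space d) 1) := by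
    refine setLIntegral_sq_le (by positivity) (image_simplex_subset Ψ s)
      ((image_mono (interior_subset.trans hsub)).trans (hΨ.image_subset_closedBall hh))
      (volume_image_frontier_eq_zero hΨ.differentiable s) ?_
    rintro _ ⟨x, hx, rfl⟩
    have h3 := (hΨ.gradient_comparison isOpen_interior (interior_subset.trans hsub3)
      (differentiable_of_mem_polySpace hW) (hvW.mono interior_subset) hx).2
    have h4 := (hup x (hsub3 (interior_subset hx))).2
    linarith
  calc ENNReal.ofReal (h ^ 2) * ∫⁻ x in Ψ '' simplex s, ‖gradient v x‖ₑ ^ 2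
      ≤ ENNReal.ofReal (h ^ 2) * (ENNReal.ofReal ((2 * h) ^ d * (2 * (A * M / h)) ^ 2) *
          volume (ball (0 : Space d) 1)) := by gcongr
    _ = ENNReal.ofReal (2 ^ d * (4 * A ^ 2) / (δ / 4) ^ d) *
          (ENNReal.ofReal ((δ / 4) ^ d * h ^ d * M ^ 2) * volume (ball (0 : Space d) 1)) := by
        rw [← mul_assoc, ← mul_assoc, ← ENNReal.ofReal_mul (by positivity),
          ← ENNReal.ofReal_mul (by positivity)]
        congr 2
        rw [mul_pow 2 h]
        field_simp
        ring
    _ ≤ _ := by gcongr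

/-- The derivative of the pullback of `v` is controlled by a number `M` whose square, scaled by
the volume of an element, is bounded by the square integral of the gradient of `v`. -/
lemma exists_gradient_lower_bound (d k : ℕ) {ρ : ℝ} (hρ : 0 < ρ) (hρ1 : ρ ≤ 1) :
    ∃ A κ : ℝ, 0 < A ∧ 0 < κ ∧ ∀ (s : Finset (Space d)) (x₀ : Space d) (h : ℝ)
      (Ψ : Space d → Space d) (v W : Space d → ℝ), 0 < h → closedBall x₀ (ρ * h) ⊆ simplex s →
      simplex s ⊆ closedBall x₀ h → IsNearId Ψ (closedBall x₀ (3 * h)) → W ∈ polySpace d k →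
      EqOn (v ∘ Ψ) W (simplex s) →
      ∃ M : ℝ, 0 ≤ M ∧ (∀ x ∈ closedBall x₀ (3 * h), ‖fderiv ℝ W x‖ ≤ A * M) ∧
        ENNReal.ofReal (κ * h ^ d * M ^ 2) * volume (ball (0 : Space d) 1) ≤
          ∫⁻ x in Ψ '' simplex s, ‖gradient v x‖ₑ ^ 2 := by
  obtain ⟨A, δ, hA, hδ, H⟩ := exists_ball_lower_bound_fderiv d k hρ hρ1
  refine ⟨A, (δ / 4) ^ d / 4, by linarith, by positivity,
    fun s x₀ h Ψ v W hh hball hsub hΨ hW hvW => ?_⟩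
  obtain ⟨M, hM, ⟨y₀, hy₀, hlow⟩, hup⟩ := H W hW x₀ h hh
  refine ⟨M, hM, hup, ?_⟩
  have hsub3 : simplex s ⊆ closedBall x₀ (3 * h) :=
    hsub.trans (closedBall_subset_closedBall (by linarith))
  have hy₀i : ball y₀ (δ * h) ⊆ interior (simplex s) :=
    interior_maximal ((hy₀.trans ball_subset_closedBall).trans hball) isOpen_ball
  have h1 := le_setLIntegral_image hh hδ (by positivity : 0 ≤ M / 2) hΨ hsub3
    (hy₀i.trans interior_subset) (g := gradient v) fun x hx => by
      have h3 := (hΨ.gradient_comparison isOpen_interior (interior_subset.trans hsub3)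
        (differentiable_of_mem_polySpace hW) (hvW.mono interior_subset) (hy₀i hx)).1
      have h4 := hlow x hx
      linarith
  refine le_trans (le_of_eq ?_) h1
  congr 2
  ring

end SquareIntegrals

/-! ### The pointwise error of the transfer operator -/

section Pointwise

variable {d : ℕ} {Ω : Set (Space d)} {K : Triangulation d Ω} {s t : Finset (Space d)}

/-- Two mesh deformations on a quasi-uniform triangulation whose mesh size is so small that the
polynomial extensions of the first one are close to the identity around each element `t`; the
point `x₀ t` is the center of a ball inscribed in `t`. -/
structure DeformationPair (K : Triangulation d Ω) (q : ℕ) (ρ C h : ℝ)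
    (Θ Θ' : Space d → Space d) (x₀ : Finset (Space d) → Space d) : Prop where
  pos : 0 < h
  const_pos : 0 < C
  ball_subset : ∀ t ∈ K.elements, closedBall (x₀ t) (ρ * h) ⊆ simplex t
  subset_ball : ∀ t ∈ K.elements, simplex t ⊆ closedBall (x₀ t) h
  old : IsMeshDeformation K q C h Θ
  new : IsMeshDeformation K q C h Θ'
  nearId : ∀ t ∈ K.elements, IsNearId (deformExt q t Θ) (closedBall (x₀ t) (3 * h))
  small : 4 * C * h ≤ 1

lemma card_nodeIndices_le {k : ℕ} (hs : s.card = d + 1) :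
    (nodeIndices k s).card ≤ (k + 1) ^ (d + 1) := by
  classical
  have hle : ∀ α ∈ nodeIndices k s, ∀ a, α a ≤ k := fun α hα a => by
    obtain ⟨h1, h2⟩ := mem_nodeIndices.1 hα
    by_cases h0 : α a = 0
    · omega
    · rw [← h1]
      exact Finset.single_le_sum (f := α) (fun _ _ => Nat.zero_le _) (h2 a h0)
  have hinj : Function.Injective
      (fun (α : nodeIndices k s) (a : s) => (⟨α.1 a, Nat.lt_succ_of_le (hle _ α.2 a)⟩ :
        Fin (k + 1))) := by
    intro α β hαβ
    refine Subtype.ext (funext fun a => ?_)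
    by_cases ha : a ∈ s
    · simpa using congrFun hαβ ⟨a, ha⟩
    · rw [not_imp_comm.1 ((mem_nodeIndices.1 α.2).2 a) ha,
        not_imp_comm.1 ((mem_nodeIndices.1 β.2).2 a) ha]
  have := Fintype.card_le_of_injective _ hinj
  simpa [hs] using this

/-- Stability of Lagrange interpolation in the maximum norm. -/
lemma IsFullSimplex.abs_sum_localBasis_le (hs : IsFullSimplex s) {k : ℕ}
    {w : (Space d → ℕ) → ℝ} {B : ℝ} (hB : 0 ≤ B) (hw : ∀ α ∈ nodeIndices k s, |w α| ≤ B)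
    {x : Space d} (hx : x ∈ simplex s) :
    |∑ α ∈ nodeIndices k s, w α * localBasis k s α x| ≤
      ((k : ℝ) + 1) ^ (d + 1) * (k : ℝ) ^ k * B := by
  calc |∑ α ∈ nodeIndices k s, w α * localBasis k s α x|
      ≤ ∑ α ∈ nodeIndices k s, |w α * localBasis k s α x| := Finset.abs_sum_le_sum_abs _ _
    _ ≤ ∑ _α ∈ nodeIndices k s, B * (k : ℝ) ^ k := by
        refine Finset.sum_le_sum fun α hα => ?_
        rw [abs_mul]
        exact mul_le_mul (hw α hα) (hs.abs_localBasis_le hα hx) (abs_nonneg _) hB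
    _ = (nodeIndices k s).card * (B * (k : ℝ) ^ k) := by rw [Finset.sum_const, nsmul_eq_mul]
    _ ≤ ((k : ℝ) + 1) ^ (d + 1) * (B * (k : ℝ) ^ k) := by
        gcongr
        exact_mod_cast card_nodeIndices_le hs.2
    _ = _ := by ring

namespace DeformationPair

variable {k q : ℕ} {ρ C h : ℝ} {Θ Θ' : Space d → Space d} {x₀ : Finset (Space d) → Space d}

lemma shift_le (D : DeformationPair K q ρ C h Θ Θ' x₀) : 4 * C * h ^ 2 ≤ h := by
  have h1 := D.small
  have h2 := D.pos
  nlinarith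

lemma inflated_subset (D : DeformationPair K q ρ C h Θ Θ' x₀) (hs : s ∈ K.elements) :
    inflated (4 * C * h ^ 2) s ⊆ closedBall (x₀ s) (3 * h) := by
  have hC := D.const_pos
  rw [inflated, (isCompact_simplex s).cthickening_eq_biUnion_closedBall (by positivity)]
  refine iUnion₂_subset fun x hx => closedBall_subset_closedBall' ?_
  have h1 := D.subset_ball s hs hx
  rw [mem_closedBall] at h1
  linarith [D.shift_le, D.pos]

lemma injOn_inflated (D : DeformationPair K q ρ C h Θ Θ' x₀) (hs : s ∈ K.elements) :
    InjOn (deformExt q s Θ) (inflated (4 * C * h ^ 2) s) :=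
  (D.nearId s hs).injOn.mono (D.inflated_subset hs)

lemma norm_new_sub_old_le (D : DeformationPair K q ρ C h Θ Θ' x₀) {x : Space d} (hx : x ∈ Ω) :
    ‖Θ' x - Θ x‖ ≤ 2 * C * h ^ 2 := by
  have h1 := D.old.small x hx
  have h2 := D.new.small x hx
  have h3 := norm_sub_le (Θ' x - x) (Θ x - x)
  rw [sub_sub_sub_cancel_right] at h3
  linarith

/-- The new deformation moves a point of `s` by at most `2 C h²` away from its old image, and the
extended old deformation covers this ball already on a ball of twice the radius. -/
lemma exists_mem_inflated (D : DeformationPair K q ρ C h Θ Θ' x₀) (hs : s ∈ K.elements)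
    {x : Space d} (hx : x ∈ simplex s) :
    ∃ z ∈ inflated (4 * C * h ^ 2) s, deformExt q s Θ z = Θ' x := by
  have hC := D.const_pos
  have hsub : closedBall x (4 * C * h ^ 2) ⊆ inflated (4 * C * h ^ 2) s :=
    closedBall_subset_cthickening hx _
  have himg := (D.nearId s hs).closedBall_subset_image (y := x) (r := 4 * C * h ^ 2)
    (by positivity) (hsub.trans (D.inflated_subset hs))
  have hmem : Θ' x ∈ closedBall (deformExt q s Θ x) (4 * C * h ^ 2 / 2) := by
    rw [mem_closedBall, dist_eq_norm, D.old.deformExt_eqOn hs hx]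
    linarith [D.norm_new_sub_old_le (simplex_subset hs hx)]
  obtain ⟨z, hz, hzx⟩ := himg hmem
  exact ⟨z, hsub hz, hzx⟩

lemma image_subset (D : DeformationPair K q ρ C h Θ Θ' x₀) (hs : s ∈ K.elements) :
    Θ' '' simplex s ⊆ deformExt q s Θ '' inflated (4 * C * h ^ 2) s := by
  rintro _ ⟨x, hx, rfl⟩
  exact D.exists_mem_inflated hs hx

variable {v : Space d → ℝ}

lemma polyExt_spec (D : DeformationPair K q ρ C h Θ Θ' x₀) (hv : v ∈ mappedFESpace K k Θ)
    (hs : s ∈ K.elements) : polyExt k s (v ∘ Θ) ∈ polySpace d k ∧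
      EqOn (polyExt k s (v ∘ Θ)) (v ∘ Θ) (simplex s) :=
  MeshTransfer.polyExt_spec (exists_poly_comp_of_mem_mappedFESpace D.old.bijOn hv hs)

lemma abs_polyExt_sub_le (D : DeformationPair K q ρ C h Θ Θ' x₀) (hv : v ∈ mappedFESpace K k Θ)
    (hs : s ∈ K.elements) {G : ℝ}
    (hG : ∀ x ∈ closedBall (x₀ s) (3 * h), ‖fderiv ℝ (polyExt k s (v ∘ Θ)) x‖ ≤ G)
    {x y : Space d} (hx : x ∈ closedBall (x₀ s) (3 * h)) (hy : y ∈ closedBall (x₀ s) (3 * h)) :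
    |polyExt k s (v ∘ Θ) x - polyExt k s (v ∘ Θ) y| ≤ G * ‖x - y‖ :=
  (convex_closedBall (x₀ s) (3 * h)).norm_image_sub_le_of_norm_fderiv_le
    (fun z _ => differentiable_of_mem_polySpace (D.polyExt_spec hv hs).1 z) hG hy hx

lemma simplex_subset_closedBall (D : DeformationPair K q ρ C h Θ Θ' x₀) (hs : s ∈ K.elements) :
    simplex s ⊆ closedBall (x₀ s) (3 * h) :=
  (D.subset_ball s hs).trans (closedBall_subset_closedBall (by linarith [D.pos]))

/-- Evaluating the extension of `v` at the shifted position of a point changes the value by at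
most the size of the shift times the maximal derivative. -/
lemma abs_elementExt_sub_le (D : DeformationPair K q ρ C h Θ Θ' x₀)
    (hv : v ∈ mappedFESpace K k Θ) (hs : s ∈ K.elements) {G : ℝ}
    (hG : ∀ x ∈ closedBall (x₀ s) (3 * h), ‖fderiv ℝ (polyExt k s (v ∘ Θ)) x‖ ≤ G)
    {x : Space d} (hx : x ∈ simplex s) :
    |elementExt k q (4 * C * h ^ 2) Θ v s (Θ' x) - polyExt k s (v ∘ Θ) x| ≤
      G * (4 * C * h ^ 2) := by
  have hz := Function.invFunOn_pos (D.exists_mem_inflated hs hx)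
  set z := Function.invFunOn (deformExt q s Θ) (inflated (4 * C * h ^ 2) s) (Θ' x) with hzdef
  have hz3 := D.inflated_subset hs hz.1
  have hx3 := D.simplex_subset_closedBall hs hx
  have hG0 : 0 ≤ G := (norm_nonneg _).trans (hG x hx3)
  have h1 := (D.nearId s hs).norm_sub_le hz3 hx3
  rw [hz.2, D.old.deformExt_eqOn hs hx] at h1
  have h2 := D.norm_new_sub_old_le (simplex_subset hs hx)
  rw [elementExt, ← hzdef]
  refine (D.abs_polyExt_sub_le hv hs hG hz3 hx3).trans ?_
  exact mul_le_mul_of_nonneg_left (by linarith) hG0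

lemma abs_shiftedInterp_sub_le (D : DeformationPair K q ρ C h Θ Θ' x₀) (hk : 1 ≤ k)
    (hv : v ∈ mappedFESpace K k Θ) (hs : s ∈ K.elements) {G : ℝ}
    (hG : ∀ x ∈ closedBall (x₀ s) (3 * h), ‖fderiv ℝ (polyExt k s (v ∘ Θ)) x‖ ≤ G)
    {x : Space d} (hx : x ∈ simplex s) :
    |shiftedInterp k q (4 * C * h ^ 2) Θ Θ' v s x - v (Θ x)| ≤
      ((k : ℝ) + 1) ^ (d + 1) * (k : ℝ) ^ k * (G * (4 * C * h ^ 2)) := by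
  have hfull := isFullSimplex_of_mem hs
  have hC := D.const_pos
  have hG0 : 0 ≤ G := (norm_nonneg _).trans (hG x (D.simplex_subset_closedBall hs hx))
  have h1 : v (Θ x) = polyExt k s (v ∘ Θ) x := ((D.polyExt_spec hv hs).2 hx).symm
  rw [h1, hfull.eq_sum_localBasis hk (D.polyExt_spec hv hs).1 x, shiftedInterp,
    ← Finset.sum_sub_distrib]
  simp only [← sub_mul]
  exact hfull.abs_sum_localBasis_le (by positivity)
    (fun α hα => D.abs_elementExt_sub_le hv hs hG (hfull.node_mem hk hα)) hx

/-- The nodal average over all elements at a point of `s` deviates from the common nodal value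
`v (Θ x)` as little as the individual elementwise values. -/
lemma abs_nodalAverage_sub_le (D : DeformationPair K q ρ C h Θ Θ' x₀) (hk : 1 ≤ k)
    (hv : v ∈ mappedFESpace K k Θ) (hs : s ∈ K.elements) {G : ℝ}
    (hG : ∀ t ∈ enlarge K {s}, ∀ x ∈ closedBall (x₀ t) (3 * h),
      ‖fderiv ℝ (polyExt k t (v ∘ Θ)) x‖ ≤ G) {x : Space d} (hx : x ∈ simplex s) :
    |nodalAverage K (shiftedInterp k q (4 * C * h ^ 2) Θ Θ' v) x - v (Θ x)| ≤
      ((k : ℝ) + 1) ^ (d + 1) * (k : ℝ) ^ k * (G * (4 * C * h ^ 2)) := by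
  have hcard : (0 : ℝ) < (elementsAt K x).card := by
    exact_mod_cast Finset.card_pos.2 ⟨s, mem_elementsAt.2 ⟨hs, hx⟩⟩
  have h1 : nodalAverage K (shiftedInterp k q (4 * C * h ^ 2) Θ Θ' v) x - v (Θ x) =
      ((elementsAt K x).card : ℝ)⁻¹ * ∑ t ∈ elementsAt K x,
        (shiftedInterp k q (4 * C * h ^ 2) Θ Θ' v t x - v (Θ x)) := by
    rw [Finset.sum_sub_distrib, Finset.sum_const, nsmul_eq_mul, mul_sub,
      inv_mul_cancel_left₀ hcard.ne', nodalAverage]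
  rw [h1, abs_mul, abs_of_pos (inv_pos.2 hcard), inv_mul_le_iff₀ hcard]
  refine (Finset.abs_sum_le_sum_abs _ _).trans ((Finset.sum_le_card_nsmul _ _ _ ?_).trans_eq
    (nsmul_eq_mul _ _))
  intro t ht
  obtain ⟨ht, hxt⟩ := mem_elementsAt.1 ht
  exact D.abs_shiftedInterp_sub_le hk hv ht
    (hG t (mem_enlarge_singleton.2 ⟨ht, exists_common_vertex hs ht hx hxt⟩)) hxt

/-- The constant of the pointwise error estimate: `L` belongs to the Lipschitz estimate along
short paths in the mesh. -/
noncomputable def errorConst (d k : ℕ) (C L : ℝ) : ℝ :=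
  2 * L * C + 4 * C * (((k : ℝ) + 1) ^ (d + 1) * (k : ℝ) ^ k) ^ 2

lemma abs_sub_transfer_le (D : DeformationPair K q ρ C h Θ Θ' x₀) (hk : 1 ≤ k)
    (hv : v ∈ mappedFESpace K k Θ) (hs : s ∈ K.elements) {G L : ℝ}
    (hG : ∀ t ∈ enlarge K {s}, ∀ x ∈ closedBall (x₀ t) (3 * h),
      ‖fderiv ℝ (polyExt k t (v ∘ Θ)) x‖ ≤ G) (hL : 1 ≤ L)
    (hlip : ∀ x ∈ simplex s, ∀ y ∈ Ω, ‖x - y‖ ≤ 2 * C * h ^ 2 →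
      ∀ (f : Space d → ℝ) (c : ℝ),
        (∀ t ∈ enlarge K {s}, ∀ u ∈ simplex t, ∀ v ∈ simplex t, |f u - f v| ≤ c * ‖u - v‖) →
        0 ≤ c → |f x - f y| ≤ L * c * ‖x - y‖)
    {x : Space d} (hx : x ∈ Θ' '' simplex s) :
    |v x - transfer K k q (4 * C * h ^ 2) Θ Θ' v x| ≤ errorConst d k C L * h ^ 2 * G := by
  obtain ⟨ξ, hξ, rfl⟩ := hx
  have hC := D.const_pos
  have hξΩ := simplex_subset hs hξ
  have hself : s ∈ enlarge K {s} := subset_enlarge (singleton_subset_iff.2 hs) rfl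
  have hfull := isFullSimplex_of_mem hs
  have hG0 : 0 ≤ G :=
    (norm_nonneg _).trans (hG s hself ξ (D.simplex_subset_closedBall hs hξ))
  -- the shift of the evaluation point, in the coordinates of the old mesh
  obtain ⟨η, hη, hηξ⟩ := D.old.bijOn.surjOn (D.new.bijOn.mapsTo hξΩ)
  have hdist : ‖ξ - η‖ ≤ 2 * C * h ^ 2 := by
    have h1 := D.old.small η hη
    have h2 := D.new.small ξ hξΩ
    have h3 := norm_sub_le (Θ η - η) (Θ' ξ - ξ)
    rw [hηξ, sub_sub_sub_cancel_left] at h3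
    rw [hηξ] at h1
    linarith
  have h1 : |v (Θ ξ) - v (Θ' ξ)| ≤ L * G * (2 * C * h ^ 2) := by
    rw [← hηξ]
    refine (hlip ξ hξ η hη hdist (v ∘ Θ) G (fun t ht x hx y hy => ?_) hG0).trans ?_
    · rw [← (D.polyExt_spec hv ht.1).2 hx, ← (D.polyExt_spec hv ht.1).2 hy]
      exact D.abs_polyExt_sub_le hv ht.1 (hG t ht) (D.simplex_subset_closedBall ht.1 hx)
        (D.simplex_subset_closedBall ht.1 hy)
    · gcongr
  have h2 : |transfer K k q (4 * C * h ^ 2) Θ Θ' v (Θ' ξ) - v (Θ ξ)| ≤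
      ((k : ℝ) + 1) ^ (d + 1) * (k : ℝ) ^ k *
        (((k : ℝ) + 1) ^ (d + 1) * (k : ℝ) ^ k * (G * (4 * C * h ^ 2))) := by
    have h3 : v (Θ ξ) = polyExt k s (v ∘ Θ) ξ := ((D.polyExt_spec hv hs).2 hξ).symm
    rw [transfer, deformInv_apply D.new.bijOn.injOn hξΩ, oswald_eq hs hξ, h3,
      hfull.eq_sum_localBasis hk (D.polyExt_spec hv hs).1 ξ, ← Finset.sum_sub_distrib]
    simp only [← sub_mul]
    refine hfull.abs_sum_localBasis_le (by positivity) (fun α hα => ?_) hξ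
    have hp := hfull.node_mem hk hα
    rw [(D.polyExt_spec hv hs).2 hp]
    exact D.abs_nodalAverage_sub_le hk hv hs hG hp
  have h4 := abs_sub_le (v (Θ' ξ)) (v (Θ ξ)) (transfer K k q (4 * C * h ^ 2) Θ Θ' v (Θ' ξ))
  rw [abs_sub_comm (v (Θ' ξ)) (v (Θ ξ)), abs_sub_comm (v (Θ ξ)) (transfer _ _ _ _ _ _ _ _)] at h4
  refine (h4.trans (add_le_add h1 h2)).trans_eq ?_
  rw [errorConst]
  ring

end DeformationPair

end Pointwise

/-! ### Summation over the elements -/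

section Summation

variable {d : ℕ} {Ω : Set (Space d)} {K : Triangulation d Ω} {s t : Finset (Space d)}
  {k q : ℕ} {ρ C h : ℝ} {Θ Θ' : Space d → Space d} {x₀ : Finset (Space d) → Space d}

namespace DeformationPair

lemma image_eq (D : DeformationPair K q ρ C h Θ Θ' x₀) (hs : s ∈ K.elements) :
    Θ '' simplex s = deformExt q s Θ '' simplex s :=
  ((D.old.deformExt_eqOn hs).image_eq).symm

lemma aedisjoint (D : DeformationPair K q ρ C h Θ Θ' x₀) (hs : s ∈ K.elements)
    (ht : t ∈ K.elements) (hne : s ≠ t) :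
    AEDisjoint volume (Θ '' simplex s) (Θ '' simplex t) := by
  refine measure_mono_null ?_
    (volume_image_frontier_eq_zero (D.nearId s hs).differentiable s)
  rintro _ ⟨⟨x, hx, rfl⟩, ⟨y, hy, hxy⟩⟩
  rw [D.old.bijOn.injOn (simplex_subset ht hy) (simplex_subset hs hx) hxy] at hy
  refine ⟨x, ⟨subset_closure hx, fun hxi => hne (eq_of_mem_interior hs ht hxi hy)⟩, ?_⟩
  exact D.old.deformExt_eqOn hs hx

/-- Integrals over a union of deformed elements are sums of integrals over these elements. -/
lemma setLIntegral_deformedDomain (D : DeformationPair K q ρ C h Θ Θ' x₀)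
    {F : Finset (Finset (Space d))} (hF : F ⊆ K.elements) (f : Space d → ENNReal) :
    ∫⁻ x in deformedDomain Θ F, f x = ∑ t ∈ F, ∫⁻ x in Θ '' simplex t, f x := by
  refine lintegral_biUnion_finset₀ (t := fun t => Θ '' simplex t)
    (fun s hs t ht hne => D.aedisjoint (hF hs) (hF ht) hne) (fun t ht => ?_) f
  exact ((isCompact_simplex t).image_of_continuousOn
    (D.old.continuousOn.mono (simplex_subset (hF ht)))).measurableSet.nullMeasurableSet

lemma lintegral_deformedDomain_le {F : Finset (Finset (Space d))} (f : Space d → ENNReal) :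
    ∫⁻ x in deformedDomain Θ F, f x ≤ ∑ t ∈ F, ∫⁻ x in Θ '' simplex t, f x := by
  classical
  induction F using Finset.induction_on with
  | empty => simp [deformedDomain]
  | insert a F ha ih =>
    have h1 : deformedDomain Θ (insert a F : Finset (Finset (Space d))) =
        Θ '' simplex a ∪ deformedDomain Θ F := by
      simp only [deformedDomain, Finset.coe_insert, biUnion_insert]
    rw [Finset.sum_insert ha, h1]
    exact (lintegral_union_le _ _ _).trans (add_le_add le_rfl ih)

/-- Summation of elementwise estimates by patches: each element belongs to boundedly many
patches. -/
lemma lintegral_le_of_patchwise (D : DeformationPair K q ρ C h Θ Θ' x₀) (hρ : 0 < ρ)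
    (hK : K.IsQuasiUniform ρ h) {f g : Space d → ENNReal} {a : ENNReal}
    (hfg : ∀ s ∈ K.elements, ∃ t ∈ enlarge K {s},
      ∫⁻ x in Θ' '' simplex s, f x ≤ a * ∫⁻ x in Θ '' simplex t, g x)
    {S : Set (Finset (Space d))} (hS : S ⊆ ↑K.elements) :
    ∫⁻ x in deformedDomain Θ' S, f x ≤
      a * ENNReal.ofReal ((2 / ρ) ^ d) * ∫⁻ x in deformedDomain Θ (enlarge K S), g x := by
  classical
  have hfin : ∀ S : Set (Finset (Space d)), S ⊆ ↑K.elements →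
      S = (K.elements.filter (· ∈ S) : Finset (Finset (Space d))) := fun S hS => by
    ext s
    simpa using fun hs => hS hs
  let E : Finset (Finset (Space d)) := K.elements.filter (· ∈ S)
  let P : Finset (Finset (Space d)) := K.elements.filter (· ∈ enlarge K S)
  have hE : S = E := hfin S hS
  have hP : enlarge K S = P := hfin _ fun t ht => ht.1
  rw [hP, D.setLIntegral_deformedDomain (Finset.filter_subset _ _)]
  conv_lhs => rw [hE]
  refine (lintegral_deformedDomain_le f).trans ?_
  calc ∑ s ∈ E, ∫⁻ x in Θ' '' simplex s, f x
      ≤ ∑ s ∈ E, ∑ t ∈ K.elements.filter (· ∈ enlarge K {s}),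
          a * ∫⁻ x in Θ '' simplex t, g x := by
        refine Finset.sum_le_sum fun s hs => ?_
        obtain ⟨t, ht, hle⟩ := hfg s (Finset.mem_filter.1 hs).1
        exact hle.trans (Finset.single_le_sum
          (f := fun t => a * ∫⁻ x in Θ '' simplex t, g x) (fun _ _ => zero_le)
          (Finset.mem_filter.2 ⟨ht.1, ht⟩))
    _ = ∑ t ∈ P, ∑ _s ∈ E.filter (fun s => t ∈ enlarge K {s}),
          a * ∫⁻ x in Θ '' simplex t, g x := by
        refine Finset.sum_comm' fun s t => ?_
        simp only [E, P, Finset.mem_filter]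
        constructor
        · rintro ⟨⟨hs, hsS⟩, ht, hts⟩
          obtain ⟨-, b, hbs, hbt⟩ := mem_enlarge_singleton.1 hts
          exact ⟨⟨⟨hs, hsS⟩, hts⟩, ht, ht, s, hsS, b, hbs, hbt⟩
        · rintro ⟨⟨hs, hts⟩, ht, -⟩
          exact ⟨hs, ht, hts⟩
    _ ≤ ∑ t ∈ P, ENNReal.ofReal ((2 / ρ) ^ d) * (a * ∫⁻ x in Θ '' simplex t, g x) := by
        refine Finset.sum_le_sum fun t ht => ?_
        rw [Finset.sum_const, nsmul_eq_mul]
        gcongr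
        rw [← ENNReal.ofReal_natCast]
        refine ENNReal.ofReal_le_ofReal
          (card_enlarge_le hρ hK (Finset.mem_filter.1 ht).1 _ fun s hs => ?_)
        obtain ⟨hsE, hts⟩ := Finset.mem_filter.1 hs
        obtain ⟨-, b, hbs, hbt⟩ := mem_enlarge_singleton.1 hts
        exact mem_enlarge_singleton.2 ⟨(Finset.mem_filter.1 hsE).1, b, hbt, hbs⟩
    _ = a * ENNReal.ofReal ((2 / ρ) ^ d) * ∑ t ∈ P, ∫⁻ x in Θ '' simplex t, g x := by
        rw [Finset.mul_sum]
        exact Finset.sum_congr rfl fun t _ => by ring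

end DeformationPair

lemma transfer_mem_mappedFESpace (K : Triangulation d Ω) (k q : ℕ) (ε : ℝ)
    (Θ Θ' : Space d → Space d) (v : Space d → ℝ) :
    transfer K k q ε Θ Θ' v ∈ mappedFESpace K k Θ' :=
  ⟨_, oswald_mem_feSpace K k _, fun _ _ => rfl⟩

lemma Triangulation.IsQuasiUniform.mono {ρ' : ℝ} (hK : K.IsQuasiUniform ρ h) (hρ : ρ' ≤ ρ) :
    K.IsQuasiUniform ρ' h :=
  ⟨hK.1, fun s hs => ⟨(hK.2 s hs).1, (hK.2 s hs).2.imp fun _ hx =>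
    (closedBall_subset_closedBall (mul_le_mul_of_nonneg_right hρ hK.1.le)).trans hx⟩⟩

end Summation

/-- The transfer estimates for a selection of elements, with constants that are uniform over all
triangulations of the domain of small mesh size and all pairs of deformations. The triangulation
`K₀` enters only through the geometry of the domain. -/
lemma exists_transfer_constants {d : ℕ} {Ω : Set (Space d)} (K₀ : Triangulation d Ω) {k q : ℕ}
    (hk : 1 ≤ k) (hq : 1 ≤ q) {ρ C : ℝ} (hρ : 0 < ρ) (hρ1 : ρ ≤ 1) (hC : 1 ≤ C) :
    ∃ h₀ c : ℝ, 0 < h₀ ∧ 0 < c ∧ ∀ (K : Triangulation d Ω) (h : ℝ), K.IsQuasiUniform ρ h →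
      h ≤ h₀ → ∀ Θ Θ' : Space d → Space d, IsMeshDeformation K q C h Θ →
      IsMeshDeformation K q C h Θ' → ∃ x₀, DeformationPair K q ρ C h Θ Θ' x₀ ∧
      ∀ v ∈ mappedFESpace K k Θ, ∀ S : Set (Finset (Space d)), S ⊆ ↑K.elements →
        l2norm (deformedDomain Θ' S) (fun x => v x - transfer K k q (4 * C * h ^ 2) Θ Θ' v x) ≤
          ENNReal.ofReal (c * h ^ 2) * l2normGrad (deformedDomain Θ (enlarge K S)) v ∧
        ENNReal.ofReal (h ^ 2) * l2normGrad (deformedDomain Θ (enlarge K S)) v ≤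
          ENNReal.ofReal (c * h) * l2norm (deformedDomain Θ (enlarge K S)) v := by
  classical
  obtain ⟨L, δ, hL, hδ, hlip⟩ := K₀.exists_patch_lipschitz hρ
  obtain ⟨A₀, hA₀, hnear⟩ := exists_isNearId_deformExt d hq hρ
  obtain ⟨c₁, hc₁, hinv⟩ := exists_inverse_estimate d k hρ hρ1
  obtain ⟨A, κ, hA, hκ, hgrad⟩ := exists_gradient_lower_bound d k hρ hρ1
  have hC0 : 0 < C := by linarith
  have hN : 0 < (2 / ρ) ^ d := by positivity
  let B : ℝ := DeformationPair.errorConst d k C L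
  have hB : 0 ≤ B := by
    simp only [B, DeformationPair.errorConst]
    positivity
  let c₂ : ℝ := 2 ^ d * (B * A) ^ 2 / κ
  have hc₂ : 0 ≤ c₂ := by positivity
  let c : ℝ := 1 + c₁ + c₂ * (2 / ρ) ^ d
  have hc1 : 1 ≤ c := by simp only [c]; nlinarith
  have hcsq : c ≤ c ^ 2 := by nlinarith
  refine ⟨min (min 1 (1 / (4 * C))) (min (1 / (2 * (A₀ * C))) (δ / (4 * C))), c, by positivity,
    by linarith, fun K h hK hh₀ Θ Θ' hΘ hΘ' => ?_⟩
  have hh : 0 < h := hK.1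
  have hh1 : h ≤ 1 := hh₀.trans ((min_le_left _ _).trans (min_le_left _ _))
  have hhC : 4 * C * h ≤ 1 := by
    have := hh₀.trans ((min_le_left _ _).trans (min_le_right _ _))
    rwa [le_div_iff₀ (by positivity), mul_comm] at this
  have hhA : A₀ * C * h ≤ 1 / 2 := by
    have := hh₀.trans ((min_le_right _ _).trans (min_le_left _ _))
    rw [le_div_iff₀ (by positivity)] at this
    linarith
  have hhδ : 4 * C * h ≤ δ := by
    have := hh₀.trans ((min_le_right _ _).trans (min_le_right _ _))
    rwa [le_div_iff₀ (by positivity), mul_comm] at this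
  have hcenter : ∀ t : Finset (Space d), ∃ x, t ∈ K.elements →
      closedBall x (ρ * h) ⊆ simplex t := fun t => by
    by_cases ht : t ∈ K.elements
    · exact ((hK.2 t ht).2).imp fun x hx _ => hx
    · exact ⟨0, fun h => absurd h ht⟩
  choose x₀ hx₀ using hcenter
  have D : DeformationPair K q ρ C h Θ Θ' x₀ :=
    { pos := hh
      const_pos := hC0
      ball_subset := hx₀
      subset_ball := fun t ht x hx => (dist_le_diam_of_mem (isCompact_simplex t).isBounded hx
        (hx₀ t ht (mem_closedBall_self (by positivity)))).trans (hK.2 t ht).1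
      old := hΘ
      new := hΘ'
      nearId := fun t ht => hnear K C h Θ hh hC0.le hhA hΘ t ht (x₀ t) (hx₀ t ht)
      small := hhC }
  refine ⟨x₀, D, fun v hv S hS => ⟨?_, ?_⟩⟩
  · have hM : ∀ t : Finset (Space d), ∃ M : ℝ, t ∈ K.elements → 0 ≤ M ∧
        (∀ x ∈ closedBall (x₀ t) (3 * h), ‖fderiv ℝ (polyExt k t (v ∘ Θ)) x‖ ≤ A * M) ∧
        ENNReal.ofReal (κ * h ^ d * M ^ 2) * volume (ball (0 : Space d) 1) ≤
          ∫⁻ x in Θ '' simplex t, ‖gradient v x‖ₑ ^ 2 := fun t => by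
      by_cases ht : t ∈ K.elements
      · obtain ⟨M, hM⟩ := hgrad t (x₀ t) h (deformExt q t Θ) v (polyExt k t (v ∘ Θ)) hh
          (D.ball_subset t ht) (D.subset_ball t ht) (D.nearId t ht) (D.polyExt_spec hv ht).1
          fun x hx => by
            rw [(D.polyExt_spec hv ht).2 hx, Function.comp_apply, Function.comp_apply,
              hΘ.deformExt_eqOn ht hx]
        exact ⟨M, fun _ => by rwa [D.image_eq ht]⟩
      · exact ⟨0, fun h => absurd h ht⟩
    choose M hM using hM
    have hpatch : ∀ s ∈ K.elements, ∃ t ∈ enlarge K {s},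
        ∫⁻ x in Θ' '' simplex s, ‖v x - transfer K k q (4 * C * h ^ 2) Θ Θ' v x‖ₑ ^ 2 ≤
          ENNReal.ofReal (c₂ * h ^ 4) * ∫⁻ x in Θ '' simplex t, ‖gradient v x‖ₑ ^ 2 := by
      intro s hs
      -- the element of the patch with the largest gradient dominates the error on `s`
      obtain ⟨t, ht, hmax⟩ := (K.elements.filter (· ∈ enlarge K {s})).exists_max_image M
        ⟨s, Finset.mem_filter.2 ⟨hs, subset_enlarge (singleton_subset_iff.2 hs) rfl⟩⟩
      obtain ⟨ht, hts⟩ := Finset.mem_filter.1 ht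
      obtain ⟨hM0, -, hMint⟩ := hM t ht
      refine ⟨t, hts, ?_⟩
      have hpt : ∀ x ∈ Θ' '' simplex s,
          ‖v x - transfer K k q (4 * C * h ^ 2) Θ Θ' v x‖ ≤ B * h ^ 2 * (A * M t) := by
        intro x hx
        refine D.abs_sub_transfer_le hk hv hs (fun t' ht' y hy => ?_) hL
          (fun x hx y hy hxy => ?_) hx
        · refine ((hM t' ht'.1).2.1 y hy).trans ?_
          gcongr
          exact hmax t' (Finset.mem_filter.2 ⟨ht'.1, ht'⟩)
        · refine hlip K h hK s hs x hx y hy ?_ ?_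
          · nlinarith
          · nlinarith
      have hsub : Θ' '' simplex s ⊆ closedBall (x₀ s) (2 * h) := by
        rintro _ ⟨x, hx, rfl⟩
        have h1 := D.subset_ball s hs hx
        have h2 := hΘ'.small x (simplex_subset hs hx)
        rw [← dist_eq_norm] at h2
        rw [mem_closedBall] at h1 ⊢
        have h3 := dist_triangle (Θ' x) x (x₀ s)
        nlinarith
      calc _ ≤ ENNReal.ofReal ((2 * h) ^ d * (B * h ^ 2 * (A * M t)) ^ 2) *
              volume (ball (0 : Space d) 1) :=
            setLIntegral_sq_le (N := ∅) (by positivity) subset_union_left hsub measure_empty hpt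
        _ = ENNReal.ofReal (c₂ * h ^ 4) * (ENNReal.ofReal (κ * h ^ d * M t ^ 2) *
              volume (ball (0 : Space d) 1)) := by
            rw [← mul_assoc (ENNReal.ofReal _) (ENNReal.ofReal _),
              ← ENNReal.ofReal_mul (by positivity)]
            congr 2
            simp only [c₂]
            rw [mul_pow 2 h]
            field_simp
        _ ≤ _ := by gcongr
    have hsum := D.lintegral_le_of_patchwise hρ hK hpatch hS
    have h1 := ofReal_mul_eLpNorm_le
      (f := fun x => v x - transfer K k q (4 * C * h ^ 2) Θ Θ' v x) (g := fun x => gradient v x)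
      (μ := volume.restrict (deformedDomain Θ' S))
      (ν := volume.restrict (deformedDomain Θ (enlarge K S)))
      (a := 1) (b := c * h ^ 2) zero_le_one (by positivity) ?_
    · simpa [l2norm, l2normGrad] using h1
    · rw [one_pow, ENNReal.ofReal_one, one_mul]
      refine hsum.trans ?_
      rw [← ENNReal.ofReal_mul (by positivity)]
      gcongr
      have : c₂ * (2 / ρ) ^ d ≤ c ^ 2 := by
        refine le_trans ?_ hcsq
        simp only [c]
        linarith
      calc c₂ * h ^ 4 * (2 / ρ) ^ d = c₂ * (2 / ρ) ^ d * h ^ 4 := by ring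
        _ ≤ c ^ 2 * h ^ 4 := by gcongr
        _ = (c * h ^ 2) ^ 2 := by ring
  · refine ofReal_mul_eLpNorm_le (by positivity) (by positivity) ?_
    have hP : enlarge K S =
        (K.elements.filter (· ∈ enlarge K S) : Finset (Finset (Space d))) := by
      ext s
      simpa using fun hs : s ∈ enlarge K S => hs.1
    rw [hP, D.setLIntegral_deformedDomain (Finset.filter_subset _ _),
      D.setLIntegral_deformedDomain (Finset.filter_subset _ _), Finset.mul_sum, Finset.mul_sum]
    refine Finset.sum_le_sum fun t ht => ?_
    have ht := (Finset.mem_filter.1 ht).1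
    have h1 := hinv t (x₀ t) h (deformExt q t Θ) v (polyExt k t (v ∘ Θ)) hh
      (D.ball_subset t ht) (D.subset_ball t ht) (D.nearId t ht) (D.polyExt_spec hv ht).1
      fun x hx => by
        rw [(D.polyExt_spec hv ht).2 hx, Function.comp_apply, Function.comp_apply,
          hΘ.deformExt_eqOn ht hx]
    rw [← D.image_eq ht] at h1
    calc ENNReal.ofReal ((h ^ 2) ^ 2) * ∫⁻ x in Θ '' simplex t, ‖gradient v x‖ₑ ^ 2
        = ENNReal.ofReal (h ^ 2) *
            (ENNReal.ofReal (h ^ 2) * ∫⁻ x in Θ '' simplex t, ‖gradient v x‖ₑ ^ 2) := by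
          rw [← mul_assoc, ← ENNReal.ofReal_mul (by positivity), sq (h ^ 2)]
      _ ≤ ENNReal.ofReal (h ^ 2) *
            (ENNReal.ofReal c₁ * ∫⁻ x in Θ '' simplex t, ‖v x‖ₑ ^ 2) := by gcongr
      _ = ENNReal.ofReal (h ^ 2 * c₁) * ∫⁻ x in Θ '' simplex t, ‖v x‖ₑ ^ 2 := by
          rw [← mul_assoc, ← ENNReal.ofReal_mul (by positivity)]
      _ ≤ _ := by
          gcongr
          have : c₁ ≤ c ^ 2 := by
            refine le_trans ?_ hcsq
            have := mul_nonneg hc₂ hN.le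
            simp only [c]
            linarith
          calc h ^ 2 * c₁ ≤ h ^ 2 * c ^ 2 := by gcongr
            _ = (c * h) ^ 2 := by ring

end MeshTransfer

theorem mainTheorem3 (d : ℕ) (hd : d = 2 ∨ d = 3) (Ω : Set (MeshTransfer.Space d))
    (k q : ℕ) (hk : 1 ≤ k) (hq : 1 ≤ q) (ρ C : ℝ) (hρ : 0 < ρ) :
    ∃ cε h₀ c : ℝ, 0 < cε ∧ 0 < h₀ ∧ 0 < c ∧
      ∀ (K : MeshTransfer.Triangulation d Ω) (h : ℝ), K.IsQuasiUniform ρ h → h ≤ h₀ →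
      ∀ (N : ℕ) (Θ : ℕ → MeshTransfer.Space d → MeshTransfer.Space d),
      (∀ i ≤ N, MeshTransfer.IsMeshDeformation K q C h (Θ i)) →
      ∀ m n : ℕ, n = m + 1 → n ≤ N →
        -- the local extensions are well defined on the new elements
        (∀ s ∈ K.elements,
          Set.InjOn (MeshTransfer.deformExt q s (Θ m)) (MeshTransfer.inflated (cε * h ^ 2) s) ∧
          Θ n '' MeshTransfer.simplex s ⊆
            MeshTransfer.deformExt q s (Θ m) '' MeshTransfer.inflated (cε * h ^ 2) s) ∧
        ∀ v ∈ MeshTransfer.mappedFESpace K k (Θ m),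
          MeshTransfer.transfer K k q (cε * h ^ 2) (Θ m) (Θ n) v ∈
            MeshTransfer.mappedFESpace K k (Θ n) ∧
          -- the local estimates
          (∀ s ∈ K.elements,
            MeshTransfer.l2norm (Θ n '' MeshTransfer.simplex s)
                (fun x => v x - MeshTransfer.transfer K k q (cε * h ^ 2) (Θ m) (Θ n) v x) ≤
              ENNReal.ofReal (c * h ^ 2) *
                MeshTransfer.l2normGrad
                  (MeshTransfer.deformedDomain (Θ m) (MeshTransfer.patch K (Θ m) s)) v ∧
            ENNReal.ofReal (h ^ 2) *
                MeshTransfer.l2normGrad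
                  (MeshTransfer.deformedDomain (Θ m) (MeshTransfer.patch K (Θ m) s)) v ≤
              ENNReal.ofReal (c * h) *
                MeshTransfer.l2norm
                  (MeshTransfer.deformedDomain (Θ m) (MeshTransfer.patch K (Θ m) s)) v) ∧
          -- the estimates on an arbitrary selection of elements
          (∀ S : Set (Finset (MeshTransfer.Space d)), S ⊆ ↑K.elements →
            MeshTransfer.l2norm (MeshTransfer.deformedDomain (Θ n) S)
                (fun x => v x - MeshTransfer.transfer K k q (cε * h ^ 2) (Θ m) (Θ n) v x) ≤
              ENNReal.ofReal (c * h ^ 2) *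
                MeshTransfer.l2normGrad
                  (MeshTransfer.deformedDomain (Θ m) (MeshTransfer.enlarge K S)) v ∧
            ENNReal.ofReal (h ^ 2) *
                MeshTransfer.l2normGrad
                  (MeshTransfer.deformedDomain (Θ m) (MeshTransfer.enlarge K S)) v ≤
              ENNReal.ofReal (c * h) *
                MeshTransfer.l2norm
                  (MeshTransfer.deformedDomain (Θ m) (MeshTransfer.enlarge K S)) v) := by
  rcases isEmpty_or_nonempty (MeshTransfer.Triangulation d Ω) with hΩ | ⟨⟨K₀⟩⟩
  · exact ⟨1, 1, 1, one_pos, one_pos, one_pos, fun K => hΩ.elim K⟩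
  -- shrinking `ρ` and enlarging `C` weakens the hypotheses
  obtain ⟨h₀, c, hh₀, hc, H⟩ := MeshTransfer.exists_transfer_constants K₀ hk hq
    (lt_min hρ one_pos) (min_le_right ρ 1) (le_max_right C 1)
  refine ⟨4 * max C 1, h₀, c, by positivity, hh₀, hc,
    fun K h hK hh N Θ hΘ m n hn hnN => ?_⟩
  obtain ⟨x₀, D, hest⟩ := H K h (hK.mono (min_le_left ρ 1)) hh (Θ m) (Θ n)
    ((hΘ m (by omega)).mono (le_max_left C 1)) ((hΘ n hnN).mono (le_max_left C 1))
  refine ⟨fun s hs => ⟨D.injOn_inflated hs, D.image_subset hs⟩, fun v hv =>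
    ⟨MeshTransfer.transfer_mem_mappedFESpace K k q _ _ _ v, fun s hs => ?_, hest v hv⟩⟩
  have h1 := hest v hv {s} (Set.singleton_subset_iff.2 hs)
  rw [← MeshTransfer.patch_eq_enlarge D.old.bijOn.injOn hs] at h1
  simpa [MeshTransfer.deformedDomain] using h1
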